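/- Let $S$ be a finite (nonempty) inverse semigroup, i.e. a semigroup in which every $x$ has a unique $x^{-1}$ with $xx^{-1}x=x$ and $x^{-1}xx^{-1}=x^{-1}$. \emph{Operations.} An operation is a complex multiplication followed by a complex addition, $x\cdot y+z$. The cost of a map $F:\mathbb C^I\to\mathbb C^J$ is the least number of operations in a straight-line computation that produces all coordinates of $F(v)$ for arbitrary $v\in\mathbb C^I$; the operands and the outputs may be arbitrary (precomputed) complex constants, coordinates of $v$, or results of earlier operations. \emph{Fourier transforms.} For a finite semigroup $T$, a representation of $\mathbb CT$ is an algebra homomorphism $\rho:\mathbb CT\to M_{d_\rho}(\mathbb C)$; it is irreducible if it is nonzero and $\mathbb C^{d_\rho}$ has no proper nonzero invariant subspace, and two representations are equivalent if they are conjugate by an invertible matrix. For a complete set $\mathcal Y$ of inequivalent irreducible representations of $\mathbb CT$, let $\mathcal T_{\mathcal Y}(T)$ be the cost of the Fourier transform $f\mapsto\bigoplus_{\rho\in\mathcal Y}\sum_{t\in T}f(t)\rho(t)$ on functions $f:T\to\mathbb C$, and let $\mathcal C(T)=\min_{\mathcal Y}\mathcal T_{\mathcal Y}(T)$ over all such $\mathcal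 Y$. \emph{Zeta transform.} Order $S$ by $s\le t$ iff $s=et$ for some idempotent $e$; let $\mu$ be the Möbius function of this poset and $\lfloor s\rfloor=\sum_{t\le s}\mu(t,s)\,t\in\mathbb CS$. The elements $\lfloor s\rfloor$ form a basis of $\mathbb CS$, the groupoid basis. Let $\mathcal C(\zeta_S)$ be the cost of the zeta transform, the map that takes the coefficients of an element of $\mathbb CS$ in the basis $\{s\}_{s\in S}$ to its coefficients in the groupoid basis. \emph{$\mathcal D$-classes.} Idempotents $a,b$ are isomorphic if $a=s^{-1}s$ and $b=ss^{-1}$ for some $s\in S$; and $s\mathrel{\mathcal D}t$ iff $s^{-1}s$ and $t^{-1}t$ are isomorphic. Let $D_0,\dots,D_n$ be the $\mathcal D$-classes of $S$, let $r_k$ be the number of idempotents in $D_k$, choose an idempotent $e_k\in D_k$ for each $k$, and let $G_k=\{s\in S: s^{-1}s=ss^{-1}=e_k\}$ be the maximal subgroup of $S$ at $e_k$. \textbf{Theorem.} For every such choice of the $e_k$, $$\mathcal C(S)\;\le\;\mathcal C(\zeta_S)+\sum_{k=0}^{n} r_k^2\,\mathcal C(G_k).$$ -/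

import Mathlib

universe u

/-! ### Inverse semigroups -/

/-- An inverse semigroup: every `x` has a unique `y` with `x y x = x` and `y x y = y`,
and this `y` is denoted `x⁻¹`. -/
class InverseSemigroup (S : Type u) extends Semigroup S, Inv S where
  mul_inv_mul : ∀ x : S, x * x⁻¹ * x = x
  inv_mul_inv : ∀ x : S, x⁻¹ * x * x⁻¹ = x⁻¹
  inv_unique : ∀ x y : S, x * y * x = x → y * x * y = y → y = x⁻¹

namespace InverseSemigroup

section Basic

variable {S : Type u} [InverseSemigroup S]

theorem inv_inv' (x : S) : x⁻¹⁻¹ = x :=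
  (inv_unique x⁻¹ x (inv_mul_inv x) (mul_inv_mul x)).symm

theorem inv_idem {e : S} (he : IsIdempotentElem e) : e⁻¹ = e := by
  have h : e * e * e = e := by rw [he.eq, he.eq]
  exact (inv_unique e e h h).symm

theorem idem_inv_mul (x : S) : IsIdempotentElem (x⁻¹ * x) := by
  change x⁻¹ * x * (x⁻¹ * x) = x⁻¹ * x
  rw [← mul_assoc, inv_mul_inv]

theorem idem_mul_inv (x : S) : IsIdempotentElem (x * x⁻¹) := by
  change x * x⁻¹ * (x * x⁻¹) = x * x⁻¹
  rw [← mul_assoc, mul_inv_mul]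

theorem idem_mul {e f : S} (he : IsIdempotentElem e) (hf : IsIdempotentElem f) :
    IsIdempotentElem (e * f) := by
  have he' : ∀ z, e * (e * z) = e * z := fun z => by rw [← mul_assoc, he.eq]
  have hf' : ∀ z, f * (f * z) = f * z := fun z => by rw [← mul_assoc, hf.eq]
  obtain ⟨x, hx⟩ : ∃ x, x = (e * f)⁻¹ := ⟨_, rfl⟩
  have h1 : e * f * x * (e * f) = e * f := hx ▸ mul_inv_mul (e * f)
  have h2 : x * (e * f) * x = x := hx ▸ inv_mul_inv (e * f)
  simp only [mul_assoc] at h1 h2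
  have h2' : ∀ z, x * (e * (f * (x * z))) = x * z := fun z => by
    have := congrArg (· * z) h2
    simpa only [mul_assoc] using this
  have hfx : f * x * e = x := by
    rw [hx]
    apply inv_unique (e * f) <;> rw [← hx] <;> simp only [mul_assoc, he', hf', h1, h2']
  have hxi : IsIdempotentElem x := by
    change x * x = x
    conv_lhs => rw [← hfx]
    simp only [mul_assoc, h2']
    simpa only [mul_assoc] using hfx
  have hef : e * f = x := by
    rw [← inv_inv' (e * f), ← hx, inv_idem hxi]
  rw [hef]
  exact hxi

theorem idem_comm {e f : S} (he : IsIdempotentElem e) (hf : IsIdempotentElem f) :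
    e * f = f * e := by
  have he' : ∀ z, e * (e * z) = e * z := fun z => by rw [← mul_assoc, he.eq]
  have hf' : ∀ z, f * (f * z) = f * z := fun z => by rw [← mul_assoc, hf.eq]
  have h1 : e * (f * (e * f)) = e * f := by
    have := (idem_mul he hf).eq
    simpa only [mul_assoc] using this
  have h2 : f * (e * (f * e)) = f * e := by
    have := (idem_mul hf he).eq
    simpa only [mul_assoc] using this
  have h := inv_unique (e * f) (f * e)
    (by simp only [mul_assoc, he', hf', h1]) (by simp only [mul_assoc, he', hf', h2])
  rw [h, inv_idem (idem_mul he hf)]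

theorem mul_inv_rev' (x y : S) : (x * y)⁻¹ = y⁻¹ * x⁻¹ := by
  have hc : x⁻¹ * x * (y * y⁻¹) = y * y⁻¹ * (x⁻¹ * x) :=
    idem_comm (idem_inv_mul x) (idem_mul_inv y)
  refine (inv_unique (x * y) (y⁻¹ * x⁻¹) ?_ ?_).symm
  · calc x * y * (y⁻¹ * x⁻¹) * (x * y) = x * (y * y⁻¹ * (x⁻¹ * x)) * y := by
          simp only [mul_assoc]
      _ = (x * x⁻¹ * x) * (y * y⁻¹ * y) := by rw [← hc]; simp only [mul_assoc]
      _ = x * y := by rw [mul_inv_mul, mul_inv_mul]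
  · calc y⁻¹ * x⁻¹ * (x * y) * (y⁻¹ * x⁻¹) = y⁻¹ * (x⁻¹ * x * (y * y⁻¹)) * x⁻¹ := by
          simp only [mul_assoc]
      _ = (y⁻¹ * y * y⁻¹) * (x⁻¹ * x * x⁻¹) := by rw [hc]; simp only [mul_assoc]
      _ = y⁻¹ * x⁻¹ := by rw [inv_mul_inv, inv_mul_inv]

/-- The natural partial order: `s ≤ t` iff `s = e t` for some idempotent `e`. -/
instance naturalOrder : PartialOrder S where
  le s t := ∃ e : S, IsIdempotentElem e ∧ s = e * t
  le_refl s := ⟨s * s⁻¹, idem_mul_inv s, (mul_inv_mul s).symm⟩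
  le_trans := by
    rintro s t w ⟨e, he, rfl⟩ ⟨f, hf, rfl⟩
    exact ⟨e * f, idem_mul he hf, (mul_assoc _ _ _).symm⟩
  le_antisymm := by
    rintro s t ⟨e, he, hs⟩ ⟨f, hf, ht⟩
    have h1 : e * s = s := by rw [hs, ← mul_assoc, he.eq]
    calc s = e * (f * s) := by rw [← ht]; exact hs
      _ = f * (e * s) := by rw [← mul_assoc, idem_comm he hf, mul_assoc]
      _ = t := by rw [h1, ← ht]

/-! ### Green's `𝒟`-relation and maximal subgroups -/

/-- Idempotents `a`, `b` are isomorphic if `a = s⁻¹ s` and `b = s s⁻¹` for some `s`. -/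
def IsoIdem (a b : S) : Prop := ∃ s : S, a = s⁻¹ * s ∧ b = s * s⁻¹

theorem IsoIdem.symm {a b : S} : IsoIdem a b → IsoIdem b a := by
  rintro ⟨s, rfl, rfl⟩
  exact ⟨s⁻¹, by rw [inv_inv'], by rw [inv_inv']⟩

theorem IsoIdem.trans {a b c : S} : IsoIdem a b → IsoIdem b c → IsoIdem a c := by
  rintro ⟨s, rfl, rfl⟩ ⟨t, h, rfl⟩
  refine ⟨t * s, ?_, ?_⟩
  · calc s⁻¹ * s = s⁻¹ * (s * s⁻¹) * s := by rw [← mul_assoc, inv_mul_inv]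
      _ = _ := by rw [h, mul_inv_rev']; simp only [mul_assoc]
  · calc t * t⁻¹ = t * (t⁻¹ * t) * t⁻¹ := by rw [← mul_assoc, mul_inv_mul]
      _ = _ := by rw [← h, mul_inv_rev']; simp only [mul_assoc]

variable (S) in
/-- `s 𝒟 t` iff the idempotents `s⁻¹ s` and `t⁻¹ t` are isomorphic. -/
def greenD : Setoid S where
  r s t := IsoIdem (s⁻¹ * s) (t⁻¹ * t)
  iseqv :=
    { refl := fun s => ⟨s⁻¹ * s, by rw [inv_idem (idem_inv_mul s), (idem_inv_mul s).eq],
        by rw [inv_idem (idem_inv_mul s), (idem_inv_mul s).eq]⟩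
      symm := IsoIdem.symm
      trans := IsoIdem.trans }

variable (S) in
/-- The set of `𝒟`-classes of `S`. -/
def DClass : Type u := Quotient (greenD S)

/-- The `𝒟`-class of an element. -/
def dClass (s : S) : DClass S := Quotient.mk (greenD S) s

noncomputable instance [Finite S] : Fintype (DClass S) :=
  haveI : Finite (DClass S) := inferInstanceAs (Finite (Quotient (greenD S)))
  Fintype.ofFinite _

/-- The number of idempotents in a `𝒟`-class. -/
noncomputable def numIdempotents (k : DClass S) : ℕ :=
  Set.ncard {a : S | IsIdempotentElem a ∧ dClass a = k}

/-- The maximal subgroup `{s | s⁻¹ s = s s⁻¹ = e}` of `S` at an idempotent `e`, with the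
multiplication of `S`. -/
def maximalSubgroup (e : S) : Subsemigroup S where
  carrier := {s | s⁻¹ * s = e ∧ s * s⁻¹ = e}
  mul_mem' := by
    rintro s t ⟨hs, hs'⟩ ⟨ht, ht'⟩
    constructor
    · calc (s * t)⁻¹ * (s * t) = t⁻¹ * (s⁻¹ * s) * t := by
            rw [mul_inv_rev']; simp only [mul_assoc]
        _ = t⁻¹ * t * t⁻¹ * t := by rw [hs, ← ht']; simp only [mul_assoc]
        _ = e := by rw [inv_mul_inv, ht]
    · calc (s * t) * (s * t)⁻¹ = s * (t * t⁻¹) * s⁻¹ := by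
            rw [mul_inv_rev']; simp only [mul_assoc]
        _ = s * s⁻¹ * s * s⁻¹ := by rw [ht', ← hs]; simp only [mul_assoc]
        _ = e := by rw [mul_inv_mul, hs']

end Basic

end InverseSemigroup

/-! ### Operation counts

One operation is a complex multiplication followed by a complex addition, `x * y + z`.
An algorithm is a straight-line computation on the input variables `v i`, `i : ι`: every operand
is a complex constant, an input variable, or the result of an earlier operation. -/

namespace OpCount

/-- The quantities (as functions of the input) that are at hand when the operations with results
`L` have been carried out: constants, input variables, and members of `L`. -/
def Available {ι : Type*} (L : List ((ι → ℂ) → ℂ)) (h : (ι → ℂ) → ℂ) : Prop :=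
  (∃ c : ℂ, h = fun _ => c) ∨ (∃ i : ι, h = fun v => v i) ∨ h ∈ L

/-- `L` is the list, most recent first, of the results of a sequence of operations. -/
inductive Computation {ι : Type*} : List ((ι → ℂ) → ℂ) → Prop
  | nil : Computation []
  | cons {L : List ((ι → ℂ) → ℂ)} {x y z : (ι → ℂ) → ℂ} (hL : Computation L)
      (hx : Available L x) (hy : Available L y) (hz : Available L z) :
      Computation ((fun v => x v * y v + z v) :: L)

/-- `F` can be computed, for arbitrary input, with `m` operations. -/
def ComputableIn {ι κ : Type*} (F : (ι → ℂ) → (κ → ℂ)) (m : ℕ) : Prop :=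
  ∃ L : List ((ι → ℂ) → ℂ), Computation L ∧ L.length = m ∧
    ∀ k : κ, Available L (fun v => F v k)

/-- The number of operations needed to compute `F` for arbitrary input (`⊤` if `F` cannot be
computed at all). -/
noncomputable def cost {ι κ : Type*} (F : (ι → ℂ) → (κ → ℂ)) : ℕ∞ :=
  ⨅ (m : ℕ) (_ : ComputableIn F m), (m : ℕ∞)

end OpCount

/-! ### Matrix representations and Fourier transforms -/

namespace SemigroupFourier

open Matrix

/-- A matrix representation of `ℂS`: a dimension `d` and an algebra homomorphism
`ℂS → M_d(ℂ)` (not required to preserve a unit, which `ℂS` need not come with). -/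
structure MatrixRep (S : Type u) [Semigroup S] where
  dim : ℕ
  hom : MonoidAlgebra ℂ S →ₙₐ[ℂ] Matrix (Fin dim) (Fin dim) ℂ

variable {S : Type u} [Semigroup S]

/-- Irreducibility: non-null and without proper nonzero invariant subspaces. -/
def MatrixRep.IsIrreducible (ρ : MatrixRep S) : Prop :=
  ρ.hom ≠ 0 ∧ ∀ W : Submodule ℂ (Fin ρ.dim → ℂ),
    (∀ a : MonoidAlgebra ℂ S, ∀ w ∈ W, ρ.hom a *ᵥ w ∈ W) → W = ⊥ ∨ W = ⊤

/-- Equivalence: `X ρ₁(a) X⁻¹ = ρ₂(a)` for all `a`, for some invertible matrix `X`. -/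
def MatrixRep.Equivalent (ρ₁ ρ₂ : MatrixRep S) : Prop :=
  ∃ (X : Matrix (Fin ρ₂.dim) (Fin ρ₁.dim) ℂ) (Z : Matrix (Fin ρ₁.dim) (Fin ρ₂.dim) ℂ),
    X * Z = 1 ∧ Z * X = 1 ∧ ∀ a : MonoidAlgebra ℂ S, X * ρ₁.hom a * Z = ρ₂.hom a

/-- `Y` is a complete set of inequivalent, irreducible representations of `ℂS`. -/
structure IsCompleteIrreducible (Y : Set (MatrixRep S)) : Prop where
  irreducible : ∀ ρ ∈ Y, ρ.IsIrreducible
  inequivalent : ∀ ρ₁ ∈ Y, ∀ ρ₂ ∈ Y, ρ₁.Equivalent ρ₂ → ρ₁ = ρ₂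
  complete : ∀ ρ : MatrixRep S, ρ.IsIrreducible → ∃ ρ' ∈ Y, ρ.Equivalent ρ'

/-- The element `∑ s, f s • s` of `ℂS` with coefficient function `f` in the semigroup basis. -/
noncomputable def toAlgebra [Finite S] (f : S → ℂ) : MonoidAlgebra ℂ S :=
  (MonoidAlgebra.basis S ℂ).equivFun.symm f

/-- The Fourier transform with respect to `Y`: all the entries of the matrices `ρ(f)`,
`ρ ∈ Y`. -/
noncomputable def fourierTransform [Finite S] (Y : Set (MatrixRep S)) (f : S → ℂ) :
    (Σ ρ : Y, Fin ρ.1.dim × Fin ρ.1.dim) → ℂ :=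
  fun p => p.1.1.hom (toAlgebra f) p.2.1 p.2.2

/-- `𝒯_Y(S)`: the number of operations needed to compute the Fourier transform with respect to
`Y` of an arbitrary function on `S`. -/
noncomputable def fourierCostWith [Finite S] (Y : Set (MatrixRep S)) : ℕ∞ :=
  OpCount.cost (fourierTransform Y)

variable (S) in
/-- `𝒞(S)`: the minimum of `𝒯_Y(S)` over all complete sets `Y` of inequivalent, irreducible
matrix representations of `ℂS`. -/
noncomputable def fourierCost [Finite S] : ℕ∞ :=
  ⨅ (Y : Set (MatrixRep S)) (_ : IsCompleteIrreducible Y), fourierCostWith Y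

end SemigroupFourier

/-! ### The groupoid basis and the zeta transform -/

namespace InverseSemigroup

variable {S : Type u} [InverseSemigroup S]

open Classical in
noncomputable instance naturalLocallyFiniteOrder [Fintype S] : LocallyFiniteOrder S :=
  Fintype.toLocallyFiniteOrder

open Classical in
/-- The groupoid basis element `⌊s⌋ = ∑_{t ≤ s} μ(t, s) t`, where `μ` is the Möbius function of
the natural partial order. -/
noncomputable def groupoidElement [Fintype S] (s : S) : MonoidAlgebra ℂ S :=
  ∑ t : S with t ≤ s, IncidenceAlgebra.mu ℂ t s • MonoidAlgebra.single t (1 : ℂ)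

open Classical in
/-- Möbius inversion: `s = ∑_{t ≤ s} ⌊t⌋`. -/
theorem sum_groupoidElement [Fintype S] (s : S) :
    ∑ t : S with t ≤ s, groupoidElement t = MonoidAlgebra.single s (1 : ℂ) := by
  have h : ∀ w : S, ∑ t : S with t ≤ s ∧ w ≤ t, IncidenceAlgebra.mu ℂ w t
      = if w = s then 1 else 0 := by
    intro w
    rw [← IncidenceAlgebra.sum_Icc_mu_right w s]
    refine Finset.sum_congr ?_ fun _ _ => rfl
    ext t
    simp [and_comm]
  calc ∑ t : S with t ≤ s, groupoidElement t
      = ∑ w : S, ∑ t : S with t ≤ s ∧ w ≤ t,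
          IncidenceAlgebra.mu ℂ w t • MonoidAlgebra.single w (1 : ℂ) := by
        simp only [groupoidElement]
        refine Finset.sum_comm' ?_
        intro x y
        simp
    _ = ∑ w : S, (if w = s then (1 : ℂ) else 0) • MonoidAlgebra.single w (1 : ℂ) := by
        refine Finset.sum_congr rfl fun w _ => ?_
        rw [← Finset.sum_smul, h w]
    _ = MonoidAlgebra.single s (1 : ℂ) := by simp

variable (S) in
/-- The groupoid basis `{⌊s⌋}` of `ℂS`. -/
noncomputable def groupoidBasis [Fintype S] : Module.Basis S ℂ (MonoidAlgebra ℂ S) :=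
  basisOfTopLeSpanOfCardEqFinrank (groupoidElement : S → MonoidAlgebra ℂ S)
    (by
      classical
      rw [← (MonoidAlgebra.basis S ℂ).span_eq, Submodule.span_le]
      rintro _ ⟨s, rfl⟩
      rw [MonoidAlgebra.basis_apply, ← sum_groupoidElement s]
      exact Submodule.sum_mem _ fun t _ => Submodule.subset_span ⟨t, rfl⟩)
    (Module.finrank_eq_card_basis (MonoidAlgebra.basis S ℂ)).symm

/-- The zeta transform: the coefficients, in the groupoid basis, of the element of `ℂS` whose
coefficients in the semigroup basis are given. -/
noncomputable def zetaTransform [Fintype S] (f : S → ℂ) : S → ℂ :=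
  (groupoidBasis S).equivFun (SemigroupFourier.toAlgebra f)

variable (S) in
/-- `𝒞(ζ_S)`: the number of operations needed to compute the zeta transform of an arbitrary
function on `S`. -/
noncomputable def zetaCost [Fintype S] : ℕ∞ :=
  OpCount.cost (zetaTransform : (S → ℂ) → (S → ℂ))

end InverseSemigroup

/-! The groupoid basis multiplies like a groupoid: `⌊s⌋⌊t⌋` is `⌊st⌋` when the domain `s⁻¹s` equals
the range `tt⁻¹`, and zero otherwise (`groupoidElement_mul`). By Möbius inversion this amounts to
the fact that every `w ≤ st` is in exactly one way a composable product of some `s' ≤ s` and `t' ≤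
t` (`sum_composable`).

Each connected component of the groupoid is a `𝒟`-class. Fix elements `p a` from `e` to each
idempotent `a` of the class of `e`. Then every element of the class is `p b * g * (p a)⁻¹` for
unique `a`, `b` and a unique `g` in the maximal subgroup at `e`, so the class contributes an algebra
of `r × r` matrices over the group algebra. This isomorphism is not constructed; representations are
transferred directly. A representation `ψ` of the subgroup on `U` induces one of `ℂS` on `r` copies
of `U`, in which `⌊p b * g * (p a)⁻¹⌋` acts as the matrix unit at `(b, a)` times `ψ g`.

Induction turns complete sets of irreducibles for all the subgroups into one for `S`
(`isCompleteIrreducible_induced`). Irreducibility and inequivalence are read off from the matrix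
units. Completeness comes from the corner `⌊e⌋V` of an irreducible `V`: it is irreducible for the
subgroup, and induces back to `V` (`corner_isIrreducible`, `induced_actionEquiv`).

By `induced_toAlgebra_single`, the `(b, a)` block of an induced representation at `f` is the Fourier
transform over the subgroup of `g ↦ ζf (p b * g * (p a)⁻¹)`. Its inputs are outputs of the zeta
transform and cost nothing further, so one zeta transform and `r²` subgroup transforms per class
suffice. -/

namespace OpCount

/-! ### Composing straight-line computations, and attaining minimal costs. -/

theorem Available.mono {ι : Type*} {L L' : List ((ι → ℂ) → ℂ)} (hL : L ⊆ L')
    {h : (ι → ℂ) → ℂ} (hh : Available L h) : Available L' h := by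
  rcases hh with hc | hi | hm
  · exact Or.inl hc
  · exact Or.inr (Or.inl hi)
  · exact Or.inr (Or.inr (hL hm))

/-- Quantities available in a computation stay available when its inputs are substituted. -/
theorem Available.comp {ι ι' : Type*} {L : List ((ι → ℂ) → ℂ)} {L' : List ((ι' → ℂ) → ℂ)}
    {σ : (ι → ℂ) → (ι' → ℂ)} (hσ : ∀ i, Available L (fun v => σ v i))
    {h : (ι' → ℂ) → ℂ} (hh : Available L' h) :
    Available (L'.map (· ∘ σ) ++ L) (fun v => h (σ v)) := by
  rcases hh with ⟨c, rfl⟩ | ⟨i, rfl⟩ | hm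
  · exact Or.inl ⟨c, rfl⟩
  · exact (hσ i).mono (List.subset_append_right _ _)
  · exact Or.inr (Or.inr (List.mem_append_left _ (List.mem_map_of_mem (f := (· ∘ σ)) hm)))

/-- This is a subroutine call: the inputs of `L'` are quantities already at hand, so passing them
costs nothing and the lengths simply add. -/
theorem Computation.comp {ι ι' : Type*} {L : List ((ι → ℂ) → ℂ)} {L' : List ((ι' → ℂ) → ℂ)}
    {σ : (ι → ℂ) → (ι' → ℂ)} (hL : Computation L) (hL' : Computation L')
    (hσ : ∀ i, Available L (fun v => σ v i)) : Computation (L'.map (· ∘ σ) ++ L) := by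
  induction hL' with
  | nil => exact hL
  | cons _ hx hy hz ih => exact .cons ih (hx.comp hσ) (hy.comp hσ) (hz.comp hσ)

/-- A computation can be continued by computing finitely many maps at available arguments. -/
theorem Computation.extend {ι τ : Type*} {ι' κ : τ → Type*} {L : List ((ι → ℂ) → ℂ)}
    (hL : Computation L) (F : ∀ t, (ι' t → ℂ) → (κ t → ℂ)) (m : τ → ℕ)
    (hF : ∀ t, ComputableIn (F t) (m t)) (σ : ∀ t, (ι → ℂ) → (ι' t → ℂ))
    (hσ : ∀ t i, Available L (fun v => σ t v i)) (A : Finset τ) :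
    ∃ L', Computation L' ∧ L ⊆ L' ∧ L'.length = L.length + ∑ t ∈ A, m t ∧
      ∀ t ∈ A, ∀ k, Available L' (fun v => F t (σ t v) k) := by
  classical
  induction A using Finset.induction_on with
  | empty => exact ⟨L, hL, List.Subset.refl _, by simp, by simp⟩
  | insert t A ht ih =>
    obtain ⟨L', hL', hsub, hlen, hav⟩ := ih
    obtain ⟨M, hM, hMlen, hMav⟩ := hF t
    have hσ' : ∀ i, Available L' (fun v => σ t v i) := fun i => (hσ t i).mono hsub
    refine ⟨M.map (· ∘ σ t) ++ L', hL'.comp hM hσ',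
      fun _ h => List.mem_append_right _ (hsub h), ?_, ?_⟩
    · rw [List.length_append, List.length_map, hMlen, hlen, Finset.sum_insert ht]
      ring
    · intro t' ht' k
      rcases Finset.mem_insert.1 ht' with rfl | h
      · exact (hMav k).comp hσ'
      · exact (hav t' h k).mono (List.subset_append_right _ _)

theorem ComputableIn.cost_le {ι κ : Type*} {F : (ι → ℂ) → (κ → ℂ)} {m : ℕ}
    (h : ComputableIn F m) : cost F ≤ m :=
  iInf₂_le m h

/-- `ℕ∞` is well ordered, so an infimum over a nonempty family is attained; over an empty family it
would be `⊤`. The minimum over complete sets of representations is handled in the same way. -/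
theorem exists_computableIn_of_cost_ne_top {ι κ : Type*} {F : (ι → ℂ) → (κ → ℂ)}
    (h : cost F ≠ ⊤) : ∃ m : ℕ, ComputableIn F m ∧ cost F = m := by
  have hne : Nonempty {m : ℕ // ComputableIn F m} := by
    by_contra hn
    refine h (iInf₂_eq_top.2 fun m hm => (hn ⟨m, hm⟩).elim)
  obtain ⟨⟨m, hm⟩, hmin⟩ := ciInf_mem (fun m : {m : ℕ // ComputableIn F m} => ((m : ℕ) : ℕ∞))
  exact ⟨m, hm, by rw [cost, iInf_subtype']; exact hmin.symm⟩

end OpCount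

namespace SemigroupFourier

theorem exists_complete_of_fourierCost_ne_top {S : Type u} [Semigroup S] [Finite S]
    (h : fourierCost S ≠ ⊤) : ∃ (Y : Set (MatrixRep S)) (m : ℕ), IsCompleteIrreducible Y ∧
      OpCount.ComputableIn (fourierTransform Y) m ∧ fourierCost S = m := by
  have hne : Nonempty {Y : Set (MatrixRep S) // IsCompleteIrreducible Y} := by
    by_contra hn
    exact h (iInf₂_eq_top.2 fun Y hY => (hn ⟨Y, hY⟩).elim)
  obtain ⟨⟨Y, hY⟩, hmin⟩ :=
    ciInf_mem (fun Y : {Y : Set (MatrixRep S) // IsCompleteIrreducible Y} =>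
      fourierCostWith Y.1)
  have hcost : fourierCost S = fourierCostWith Y := by
    rw [fourierCost, iInf_subtype']
    exact hmin.symm
  obtain ⟨m, hm, hm'⟩ := OpCount.exists_computableIn_of_cost_ne_top (hcost ▸ h)
  exact ⟨Y, m, hY, hm, hcost.trans hm'⟩

end SemigroupFourier

/-! ### The groupoid multiplication on the semigroup algebra. -/

namespace InverseSemigroup

variable {S : Type u} [InverseSemigroup S]

theorem idem_conj {f : S} (hf : IsIdempotentElem f) (s : S) :
    IsIdempotentElem (s * f * s⁻¹) := by
  have h : s⁻¹ * s * f = f * (s⁻¹ * s) := idem_comm (idem_inv_mul s) hf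
  calc s * f * s⁻¹ * (s * f * s⁻¹) = s * f * (s⁻¹ * s * f) * s⁻¹ := by simp only [mul_assoc]
    _ = s * (f * f) * (s⁻¹ * s * s⁻¹) := by rw [h]; simp only [mul_assoc]
    _ = s * f * s⁻¹ := by rw [hf.eq, inv_mul_inv]

theorem idem_mul_le {e : S} (he : IsIdempotentElem e) (s : S) : e * s ≤ s := ⟨e, he, rfl⟩

/-- An element below `s` is thus determined by its range idempotent, which gives the uniqueness of
factorizations in `sum_composable`. -/
theorem eq_of_le {u s : S} (h : u ≤ s) : u * u⁻¹ * s = u := by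
  obtain ⟨e, he, rfl⟩ := h
  have hc : s * s⁻¹ * e = e * (s * s⁻¹) := idem_comm (idem_mul_inv s) he
  calc e * s * (e * s)⁻¹ * s = e * (s * s⁻¹ * e) * s := by
        rw [mul_inv_rev', inv_idem he]; simp only [mul_assoc]
    _ = e * e * (s * s⁻¹ * s) := by rw [hc]; simp only [mul_assoc]
    _ = e * s := by rw [he.eq, mul_inv_mul]

theorem mul_le_mul'' {s s' t t' : S} (hs : s' ≤ s) (ht : t' ≤ t) : s' * t' ≤ s * t := by
  obtain ⟨e, he, rfl⟩ := hs
  obtain ⟨f, hf, rfl⟩ := ht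
  -- The idempotent `f` is moved to the left past `s`, where it becomes its conjugate.
  refine ⟨e * (s * f * s⁻¹), idem_mul he (idem_conj hf s), ?_⟩
  have h : s⁻¹ * s * f = f * (s⁻¹ * s) := idem_comm (idem_inv_mul s) hf
  calc e * s * (f * t) = e * (s * s⁻¹ * s) * f * t := by
        rw [mul_inv_mul]; simp only [mul_assoc]
    _ = e * s * (s⁻¹ * s * f) * t := by simp only [mul_assoc]
    _ = _ := by rw [h]; simp only [mul_assoc]

/-- The range idempotent of a composable product. -/
theorem mul_range {s t : S} (h : s⁻¹ * s = t * t⁻¹) : s * t * (s * t)⁻¹ = s * s⁻¹ := by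
  calc s * t * (s * t)⁻¹ = s * (t * t⁻¹) * s⁻¹ := by
        rw [mul_inv_rev']; simp only [mul_assoc]
    _ = s * s⁻¹ * s * s⁻¹ := by rw [← h]; simp only [mul_assoc]
    _ = s * s⁻¹ := by rw [mul_inv_mul]

/-- The domain idempotent of a composable product. -/
theorem mul_domain {s t : S} (h : s⁻¹ * s = t * t⁻¹) : (s * t)⁻¹ * (s * t) = t⁻¹ * t := by
  calc (s * t)⁻¹ * (s * t) = t⁻¹ * (s⁻¹ * s) * t := by
        rw [mul_inv_rev']; simp only [mul_assoc]
    _ = t⁻¹ * t * t⁻¹ * t := by rw [h]; simp only [mul_assoc]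
    _ = t⁻¹ * t := by rw [inv_mul_inv]

section GroupoidAlgebra

variable [Fintype S]

theorem groupoidBasis_apply (s : S) : groupoidBasis S s = groupoidElement s := by
  simp [groupoidBasis]

-- Every `w ≤ s * t` factors uniquely as a composable product of `s' ≤ s` and `t' ≤ t`: the range of
-- `s'` has to be `w * w⁻¹`, the range of `t'` has to be the domain of `s'`, and an element below a
-- given one is determined by its range.
open Classical in
theorem sum_composable (s t : S) :
    ∑ s' : S with s' ≤ s, ∑ t' : S with t' ≤ t,
      (if s'⁻¹ * s' = t' * t'⁻¹ then groupoidElement (s' * t') else 0) =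
      ∑ w : S with w ≤ s * t, groupoidElement w := by
  rw [← Finset.sum_product', ← Finset.sum_filter]
  refine Finset.sum_bij' (fun p _ => p.1 * p.2)
    (fun w _ => (w * w⁻¹ * s, (w * w⁻¹ * s)⁻¹ * (w * w⁻¹ * s) * t)) ?_ ?_ ?_ ?_ ?_
  · rintro ⟨s', t'⟩ h
    simp only [Finset.mem_filter, Finset.mem_product, Finset.mem_univ, true_and] at h ⊢
    exact mul_le_mul'' h.1.1 h.1.2
  · intro w h
    simp only [Finset.mem_filter, Finset.mem_product, Finset.mem_univ, true_and] at h ⊢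
    refine ⟨⟨idem_mul_le (idem_mul_inv w) s, idem_mul_le (idem_inv_mul _) t⟩, ?_⟩
    have hw := eq_of_le h
    set e := w * w⁻¹ with he
    have hei : IsIdempotentElem e := idem_mul_inv w
    have he' : e * s * t * (e * s * t)⁻¹ = e := by rw [mul_assoc e, hw]
    set x := e * s with hx
    -- Since `x * t` still has range `e`, no part of the domain of `x` is lost on meeting `t`; so
    -- the restriction of `t` to that domain has range exactly `x⁻¹ * x`.
    have h1 : x⁻¹ * x * (t * t⁻¹) = t * t⁻¹ * (x⁻¹ * x) :=
      idem_comm (idem_inv_mul x) (idem_mul_inv t)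
    have h2 : e * x = x := by rw [hx, ← mul_assoc, hei.eq]
    have h3 : x * (t * t⁻¹) * x⁻¹ = e := by
      rw [← he', mul_inv_rev' x t]; simp only [mul_assoc]
    symm
    calc x⁻¹ * x * t * (x⁻¹ * x * t)⁻¹
        = x⁻¹ * x * (t * t⁻¹) * (x⁻¹ * x) := by
          rw [mul_inv_rev' _ t, inv_idem (idem_inv_mul x)]; simp only [mul_assoc]
      _ = x⁻¹ * (x * (t * t⁻¹) * x⁻¹) * x := by simp only [mul_assoc]
      _ = x⁻¹ * x := by rw [h3, mul_assoc, h2]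
  · rintro ⟨s', t'⟩ h
    simp only [Finset.mem_filter, Finset.mem_product, Finset.mem_univ, true_and] at h
    obtain ⟨⟨hs, ht⟩, hc⟩ := h
    simp only [Prod.mk.injEq]
    have h1 : s' * t' * (s' * t')⁻¹ * s = s' := by rw [mul_range hc, eq_of_le hs]
    rw [h1]
    exact ⟨rfl, by rw [hc, eq_of_le ht]⟩
  · intro w h
    simp only [Finset.mem_filter, Finset.mem_univ, true_and] at h
    have hw := eq_of_le h
    change w * w⁻¹ * s * ((w * w⁻¹ * s)⁻¹ * (w * w⁻¹ * s) * t) = w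
    rw [← mul_assoc, ← mul_assoc, mul_inv_mul, mul_assoc _ s t, hw]
  · intros
    rfl

open Classical in
/-- The groupoid basis multiplies like the underlying groupoid. -/
theorem groupoidElement_mul (s t : S) :
    (groupoidElement s * groupoidElement t : MonoidAlgebra ℂ S) =
      if s⁻¹ * s = t * t⁻¹ then groupoidElement (s * t) else 0 := by
  let B : MonoidAlgebra ℂ S →ₗ[ℂ] MonoidAlgebra ℂ S →ₗ[ℂ] MonoidAlgebra ℂ S :=
    (groupoidBasis S).constr ℂ fun s => (groupoidBasis S).constr ℂ fun t =>
      if s⁻¹ * s = t * t⁻¹ then groupoidElement (s * t) else 0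
  have hB : ∀ s t, B (groupoidElement s) (groupoidElement t) =
      if s⁻¹ * s = t * t⁻¹ then groupoidElement (s * t) else 0 := by
    intro s t
    rw [← groupoidBasis_apply, ← groupoidBasis_apply]
    simp only [B, Module.Basis.constr_basis]
  -- `B` is the product that the groupoid rule would define. It is compared with the true product on
  -- the semigroup basis, where the latter is known; Möbius inversion turns the comparison into
  -- `sum_composable`.
  have h : B = LinearMap.mul ℂ (MonoidAlgebra ℂ S) := by
    refine (MonoidAlgebra.basis S ℂ).ext fun s => (MonoidAlgebra.basis S ℂ).ext fun t => ?_
    rw [MonoidAlgebra.basis_apply, MonoidAlgebra.basis_apply, LinearMap.mul_apply',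
      MonoidAlgebra.single_mul_single, mul_one, ← sum_groupoidElement (s * t),
      ← sum_composable, ← sum_groupoidElement s, ← sum_groupoidElement t]
    simp only [map_sum, LinearMap.sum_apply, hB]
    exact Finset.sum_comm
  rw [← hB, h, LinearMap.mul_apply']

theorem groupoidElement_mul_of_eq {s t : S} (h : s⁻¹ * s = t * t⁻¹) :
    (groupoidElement s * groupoidElement t : MonoidAlgebra ℂ S) = groupoidElement (s * t) := by
  rw [groupoidElement_mul, if_pos h]

theorem groupoidElement_mul_of_ne {s t : S} (h : s⁻¹ * s ≠ t * t⁻¹) :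
    (groupoidElement s * groupoidElement t : MonoidAlgebra ℂ S) = 0 := by
  rw [groupoidElement_mul, if_neg h]

open Classical in
/-- The algebra homomorphism given on the groupoid basis by a map compatible with the
groupoid multiplication. -/
noncomputable def groupoidLift {A : Type*} [Semiring A] [Algebra ℂ A] (R : S → A)
    (hR : ∀ s t, R s * R t = if s⁻¹ * s = t * t⁻¹ then R (s * t) else 0) :
    MonoidAlgebra ℂ S →ₙₐ[ℂ] A :=
  { (groupoidBasis S).constr ℂ R with
    map_zero' := map_zero ((groupoidBasis S).constr ℂ R)
    map_mul' := by
      intro x y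
      let M : MonoidAlgebra ℂ S →ₗ[ℂ] A := (groupoidBasis S).constr ℂ R
      change M (x * y) = M x * M y
      have h : (LinearMap.mul ℂ (MonoidAlgebra ℂ S)).compr₂ M =
          (LinearMap.mul ℂ A).compl₁₂ M M := by
        refine (groupoidBasis S).ext fun s => (groupoidBasis S).ext fun t => ?_
        have hM : ∀ s, M (groupoidElement s) = R s := fun s => by
          rw [← groupoidBasis_apply]
          exact Module.Basis.constr_basis _ _ _ _
        simp only [LinearMap.compr₂_apply, LinearMap.compl₁₂_apply, LinearMap.mul_apply',
          groupoidBasis_apply, hM, hR, groupoidElement_mul]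
        split_ifs
        · exact hM _
        · exact map_zero _
      simpa only [LinearMap.compr₂_apply, LinearMap.compl₁₂_apply, LinearMap.mul_apply'] using
        LinearMap.congr_fun₂ h x y }

open Classical in
theorem groupoidLift_groupoidElement {A : Type*} [Semiring A] [Algebra ℂ A] (R : S → A)
    (hR : ∀ s t, R s * R t = if s⁻¹ * s = t * t⁻¹ then R (s * t) else 0) (s : S) :
    groupoidLift R hR (groupoidElement s) = R s := by
  have h := Module.Basis.constr_basis (groupoidBasis S) ℂ R s
  rw [groupoidBasis_apply] at h
  exact h

/-- Expansion of an element of `ℂS` along the groupoid basis by the zeta transform. -/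
theorem toAlgebra_eq_sum_zetaTransform (f : S → ℂ) :
    SemigroupFourier.toAlgebra f = ∑ s, zetaTransform f s • groupoidElement s := by
  rw [zetaTransform]
  conv_lhs => rw [← (groupoidBasis S).sum_equivFun (SemigroupFourier.toAlgebra f)]
  simp only [groupoidBasis_apply]

end GroupoidAlgebra

end InverseSemigroup

namespace SemigroupFourier

/-! ### Basis-free representations -/

variable {T : Type u} [Semigroup T] {V V' V'' : Type*} [AddCommGroup V] [Module ℂ V]
  [AddCommGroup V'] [Module ℂ V'] [AddCommGroup V''] [Module ℂ V'']

/-- Irreducibility of a representation on a vector space. -/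
def IsIrreducibleAction (φ : MonoidAlgebra ℂ T →ₙₐ[ℂ] Module.End ℂ V) : Prop :=
  φ ≠ 0 ∧ ∀ W : Submodule ℂ V, (∀ a : MonoidAlgebra ℂ T, ∀ w ∈ W, φ a w ∈ W) → W = ⊥ ∨ W = ⊤

/-- Isomorphism of representations on vector spaces. -/
def ActionEquiv (φ : MonoidAlgebra ℂ T →ₙₐ[ℂ] Module.End ℂ V)
    (φ' : MonoidAlgebra ℂ T →ₙₐ[ℂ] Module.End ℂ V') : Prop :=
  ∃ f : V ≃ₗ[ℂ] V', ∀ a v, f (φ a v) = φ' a (f v)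

theorem ActionEquiv.symm {φ : MonoidAlgebra ℂ T →ₙₐ[ℂ] Module.End ℂ V}
    {φ' : MonoidAlgebra ℂ T →ₙₐ[ℂ] Module.End ℂ V'} (h : ActionEquiv φ φ') :
    ActionEquiv φ' φ := by
  obtain ⟨f, hf⟩ := h
  exact ⟨f.symm, fun a v => by rw [f.symm_apply_eq, hf, f.apply_symm_apply]⟩

theorem ActionEquiv.trans {φ : MonoidAlgebra ℂ T →ₙₐ[ℂ] Module.End ℂ V}
    {φ' : MonoidAlgebra ℂ T →ₙₐ[ℂ] Module.End ℂ V'}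
    {φ'' : MonoidAlgebra ℂ T →ₙₐ[ℂ] Module.End ℂ V''}
    (h : ActionEquiv φ φ') (h' : ActionEquiv φ' φ'') : ActionEquiv φ φ'' := by
  obtain ⟨f, hf⟩ := h
  obtain ⟨g, hg⟩ := h'
  exact ⟨f.trans g, fun a v => by rw [f.trans_apply, hf, hg, f.trans_apply]⟩

theorem ActionEquiv.isIrreducible {φ : MonoidAlgebra ℂ T →ₙₐ[ℂ] Module.End ℂ V}
    {φ' : MonoidAlgebra ℂ T →ₙₐ[ℂ] Module.End ℂ V'} (h : ActionEquiv φ φ')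
    (hφ : IsIrreducibleAction φ) : IsIrreducibleAction φ' := by
  obtain ⟨f, hf⟩ := h
  refine ⟨?_, fun W hW => ?_⟩
  · rintro rfl
    refine hφ.1 (NonUnitalAlgHom.ext fun a => LinearMap.ext fun v => f.injective ?_)
    rw [hf]
    simp
  · rcases hφ.2 (W.comap f.toLinearMap) (fun a w hw => by
      change f (φ a w) ∈ W
      rw [hf]
      exact hW a _ hw) with h | h
    · refine Or.inl ((Submodule.eq_bot_iff _).2 fun w hw => ?_)
      have h0 : f.symm w ∈ W.comap f.toLinearMap := by simpa using hw
      rw [h, Submodule.mem_bot] at h0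
      simpa using h0
    · refine Or.inr (Submodule.eq_top_iff'.2 fun w => ?_)
      have h0 : f.symm w ∈ W.comap f.toLinearMap := by rw [h]; trivial
      simpa using h0

/-- Schur's lemma: a nonzero intertwiner of irreducible representations is an isomorphism. -/
theorem actionEquiv_of_intertwiner {φ : MonoidAlgebra ℂ T →ₙₐ[ℂ] Module.End ℂ V}
    {φ' : MonoidAlgebra ℂ T →ₙₐ[ℂ] Module.End ℂ V'} (hφ : IsIrreducibleAction φ)
    (hφ' : IsIrreducibleAction φ') (f : V →ₗ[ℂ] V') (hf : ∀ a v, f (φ a v) = φ' a (f v))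
    (h0 : f ≠ 0) : ActionEquiv φ φ' := by
  have hker : LinearMap.ker f = ⊥ := by
    refine (hφ.2 _ fun a w hw => ?_).resolve_right fun h => h0 (LinearMap.ker_eq_top.1 h)
    rw [LinearMap.mem_ker] at hw ⊢
    rw [hf, hw, map_zero]
  have hrange : LinearMap.range f = ⊤ := by
    refine (hφ'.2 _ ?_).resolve_left fun h => h0 (LinearMap.range_eq_bot.1 h)
    rintro a _ ⟨v, rfl⟩
    exact ⟨φ a v, hf a v⟩
  exact ⟨LinearEquiv.ofBijective f
    ⟨LinearMap.ker_eq_bot.1 hker, LinearMap.range_eq_top.1 hrange⟩, hf⟩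

/-- Invariance need only be tested on a basis of the algebra: the groupoid basis for `S`, the group
elements for a maximal subgroup. -/
theorem action_mem_of_basis {ι : Type*} (b : Module.Basis ι ℂ (MonoidAlgebra ℂ T))
    (φ : MonoidAlgebra ℂ T →ₙₐ[ℂ] Module.End ℂ V) (W : Submodule ℂ V) (w : V)
    (h : ∀ i, φ (b i) w ∈ W) (x : MonoidAlgebra ℂ T) : φ x w ∈ W := by
  induction b.mem_span x using Submodule.span_induction with
  | mem x hx =>
    obtain ⟨i, rfl⟩ := hx
    exact h i
  | zero => rw [map_zero]; exact W.zero_mem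
  | add x y _ _ hx hy => rw [map_add]; exact W.add_mem hx hy
  | smul c x _ hx => rw [map_smul]; exact W.smul_mem c hx

theorem intertwine_of_basis {ι : Type*} (b : Module.Basis ι ℂ (MonoidAlgebra ℂ T))
    {φ : MonoidAlgebra ℂ T →ₙₐ[ℂ] Module.End ℂ V}
    {φ' : MonoidAlgebra ℂ T →ₙₐ[ℂ] Module.End ℂ V'} (f : V →ₗ[ℂ] V') (v : V)
    (h : ∀ i, f (φ (b i) v) = φ' (b i) (f v)) (x : MonoidAlgebra ℂ T) :
    f (φ x v) = φ' x (f v) := by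
  induction b.mem_span x using Submodule.span_induction with
  | mem x hx =>
    obtain ⟨i, rfl⟩ := hx
    exact h i
  | zero => simp
  | add x y _ _ hx hy => simp [hx, hy]
  | smul c x _ hx => simp [hx]

theorem eq_zero_of_basis {ι : Type*} (b : Module.Basis ι ℂ (MonoidAlgebra ℂ T))
    {φ : MonoidAlgebra ℂ T →ₙₐ[ℂ] Module.End ℂ V} (h : ∀ i, φ (b i) = 0) : φ = 0 := by
  refine NonUnitalAlgHom.ext fun x => LinearMap.ext fun v => ?_
  have := action_mem_of_basis b φ ⊥ v (fun i => by rw [h i]; simp) x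
  simpa using this

theorem toAlgebra_eq_sum {T : Type u} [Fintype T] (f : T → ℂ) :
    toAlgebra f = ∑ t, f t • MonoidAlgebra.single t (1 : ℂ) := by
  rw [toAlgebra, Module.Basis.equivFun_symm_apply]
  refine Finset.sum_congr (by congr!) fun t _ => ?_
  rw [MonoidAlgebra.basis_apply]

/-! ### Matrix representations as actions -/

/-- The action on column vectors of a matrix representation. -/
noncomputable def MatrixRep.action (ρ : MatrixRep T) :
    MonoidAlgebra ℂ T →ₙₐ[ℂ] Module.End ℂ (Fin ρ.dim → ℂ) :=
  ((Matrix.toLinAlgEquiv' : Matrix (Fin ρ.dim) (Fin ρ.dim) ℂ ≃ₐ[ℂ] _) :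
    Matrix (Fin ρ.dim) (Fin ρ.dim) ℂ →ₙₐ[ℂ] Module.End ℂ (Fin ρ.dim → ℂ)).comp ρ.hom

theorem MatrixRep.action_apply (ρ : MatrixRep T) (a : MonoidAlgebra ℂ T) (v : Fin ρ.dim → ℂ) :
    ρ.action a v = (ρ.hom a).mulVec v := rfl

theorem MatrixRep.isIrreducible_iff (ρ : MatrixRep T) :
    ρ.IsIrreducible ↔ IsIrreducibleAction ρ.action := by
  have h : ρ.hom = 0 ↔ ρ.action = 0 := by
    constructor
    · intro h
      refine NonUnitalAlgHom.ext fun a => LinearMap.ext fun v => ?_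
      rw [ρ.action_apply, h]
      simp
    · intro h
      refine NonUnitalAlgHom.ext fun a => Matrix.toLin'.injective (LinearMap.ext fun v => ?_)
      rw [Matrix.toLin'_apply, ← ρ.action_apply, h]
      simp
  rw [MatrixRep.IsIrreducible, IsIrreducibleAction, Ne, Ne, h]
  rfl

theorem MatrixRep.equivalent_iff (ρ₁ ρ₂ : MatrixRep T) :
    ρ₁.Equivalent ρ₂ ↔ ActionEquiv ρ₁.action ρ₂.action := by
  constructor
  · rintro ⟨X, Z, hXZ, hZX, h⟩
    refine ⟨LinearEquiv.ofLinearMap (Matrix.toLin' X) (Matrix.toLin' Z)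
      (by rw [← Matrix.toLin'_mul, hXZ, Matrix.toLin'_one])
      (by rw [← Matrix.toLin'_mul, hZX, Matrix.toLin'_one]), fun a v => ?_⟩
    simp only [MatrixRep.action_apply, LinearEquiv.coe_ofLinearMap, Matrix.toLin'_apply,
      Matrix.mulVec_mulVec]
    rw [← h, Matrix.mul_assoc, Matrix.mul_assoc, hZX, Matrix.mul_one]
  · rintro ⟨f, hf⟩
    have h1 : LinearMap.toMatrix' f.toLinearMap * LinearMap.toMatrix' f.symm.toLinearMap = 1 := by
      rw [← LinearMap.toMatrix'_comp, LinearEquiv.comp_symm, LinearMap.toMatrix'_id]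
    have h2 : LinearMap.toMatrix' f.symm.toLinearMap * LinearMap.toMatrix' f.toLinearMap = 1 := by
      rw [← LinearMap.toMatrix'_comp, LinearEquiv.symm_comp, LinearMap.toMatrix'_id]
    refine ⟨_, _, h1, h2, fun a => ?_⟩
    have h3 : LinearMap.toMatrix' f.toLinearMap * ρ₁.hom a =
        ρ₂.hom a * LinearMap.toMatrix' f.toLinearMap := by
      refine Matrix.toLin'.injective (LinearMap.ext fun v => ?_)
      rw [Matrix.toLin'_mul, Matrix.toLin'_mul, Matrix.toLin'_toMatrix']
      exact hf a v
    rw [h3, Matrix.mul_assoc, h1, Matrix.mul_one]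

/-- The matrix representation of an action with respect to a basis. -/
noncomputable def MatrixRep.ofBasis {ι : Type*} [Fintype ι] (b : Module.Basis ι ℂ V)
    (φ : MonoidAlgebra ℂ T →ₙₐ[ℂ] Module.End ℂ V) : MatrixRep T where
  dim := Fintype.card ι
  hom := ((LinearMap.toMatrixAlgEquiv (b.reindex (Fintype.equivFin ι))) :
    Module.End ℂ V →ₙₐ[ℂ] Matrix (Fin (Fintype.card ι)) (Fin (Fintype.card ι)) ℂ).comp φ

theorem MatrixRep.ofBasis_hom_apply {ι : Type*} [Fintype ι] (b : Module.Basis ι ℂ V)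
    (φ : MonoidAlgebra ℂ T →ₙₐ[ℂ] Module.End ℂ V) (x : MonoidAlgebra ℂ T)
    (i j : Fin (MatrixRep.ofBasis b φ).dim) :
    (MatrixRep.ofBasis b φ).hom x i j =
      b.repr (φ x (b ((Fintype.equivFin ι).symm j))) ((Fintype.equivFin ι).symm i) := by
  have h : ∀ i j : Fin (Fintype.card ι),
      LinearMap.toMatrixAlgEquiv (b.reindex (Fintype.equivFin ι)) (φ x) i j =
        b.repr (φ x (b ((Fintype.equivFin ι).symm j))) ((Fintype.equivFin ι).symm i) :=
    fun i j => by
      rw [LinearMap.toMatrixAlgEquiv_apply, Module.Basis.reindex_apply,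
        Module.Basis.repr_reindex_apply]
  exact h i j

theorem MatrixRep.ofBasis_actionEquiv {ι : Type*} [Fintype ι] (b : Module.Basis ι ℂ V)
    (φ : MonoidAlgebra ℂ T →ₙₐ[ℂ] Module.End ℂ V) :
    ActionEquiv φ (MatrixRep.ofBasis b φ).action := by
  refine ⟨(b.reindex (Fintype.equivFin ι)).equivFun, fun a v => ?_⟩
  rw [MatrixRep.action_apply]
  exact (LinearMap.toMatrix_mulVec_repr (b.reindex (Fintype.equivFin ι))
    (b.reindex (Fintype.equivFin ι)) (φ a) v).symm

end SemigroupFourier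

namespace InverseSemigroup

open SemigroupFourier

variable {S : Type u} [InverseSemigroup S] {e : S}

/-! ### Representations induced from a maximal subgroup -/

/-- The idempotents in the `𝒟`-class of `e`. -/
def ClassIdem (e : S) : Type u := {a : S // IsIdempotentElem a ∧ dClass a = dClass e}

theorem dClass_eq_iff {s t : S} : dClass s = dClass t ↔ IsoIdem (s⁻¹ * s) (t⁻¹ * t) :=
  ⟨fun h => Quotient.exact h, fun h => Quotient.sound h⟩

theorem dClass_inv_mul (s : S) : dClass (s⁻¹ * s) = dClass s := by
  rw [dClass_eq_iff, inv_idem (idem_inv_mul s), (idem_inv_mul s).eq]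
  exact (greenD S).refl s

theorem dClass_mul_inv (s : S) : dClass (s * s⁻¹) = dClass s := by
  rw [dClass_eq_iff, inv_idem (idem_mul_inv s), (idem_mul_inv s).eq]
  exact IsoIdem.symm ⟨s, rfl, rfl⟩

variable (he : IsIdempotentElem e)

include he in
theorem exists_transporter (a : ClassIdem e) : ∃ p : S, p⁻¹ * p = e ∧ p * p⁻¹ = a.1 := by
  obtain ⟨a, ha, hd⟩ := a
  rw [dClass_eq_iff, inv_idem ha, ha.eq, inv_idem he, he.eq] at hd
  obtain ⟨p, h1, h2⟩ := hd.symm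
  exact ⟨p, h1.symm, h2.symm⟩

/-- A chosen element with domain `e` and range `a`. -/
noncomputable def transporter (a : ClassIdem e) : S := (exists_transporter he a).choose

theorem transporter_domain (a : ClassIdem e) :
    (transporter he a)⁻¹ * transporter he a = e := (exists_transporter he a).choose_spec.1

theorem transporter_range (a : ClassIdem e) :
    transporter he a * (transporter he a)⁻¹ = a.1 := (exists_transporter he a).choose_spec.2

theorem mul_transporter_inv (a : ClassIdem e) :
    e * (transporter he a)⁻¹ = (transporter he a)⁻¹ := by
  have h := inv_mul_inv (transporter he a)
  rwa [transporter_domain] at h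

/-- The product runs from `e` to `a`, along `s` to `b`, and back to `e`, so it is a loop at `e`. For
fixed `a` and `b` this passage from arrows to loops is inverse to `arrow`. -/
theorem transport_mem {s : S} {a b : ClassIdem e} (h : s⁻¹ * s = a.1 ∧ s * s⁻¹ = b.1) :
    (transporter he b)⁻¹ * s * transporter he a ∈ maximalSubgroup e := by
  have h1 : (transporter he b)⁻¹⁻¹ = transporter he b := inv_inv' _
  have h2 : (transporter he b)⁻¹⁻¹ * (transporter he b)⁻¹ = s * s⁻¹ := by
    rw [h1, transporter_range, h.2]
  have h3 := mul_domain h2.symm.symm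
  have h4 := mul_range h2
  have h5 : ((transporter he b)⁻¹ * s)⁻¹ * ((transporter he b)⁻¹ * s) =
      transporter he a * (transporter he a)⁻¹ := by rw [h3, transporter_range, h.1]
  constructor
  · rw [mul_domain h5, transporter_domain]
  · rw [mul_range h5, h4, h1, transporter_domain]

theorem idem_mul_maximalSubgroup (g : maximalSubgroup e) : e * g.1 = g.1 := by
  have h := mul_inv_mul g.1
  rwa [g.2.2] at h

theorem maximalSubgroup_mul_idem (g : maximalSubgroup e) : g.1 * e = g.1 := by
  have h := mul_inv_mul g.1
  rwa [mul_assoc, g.2.1] at h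

/-- The element of `S` with domain `a` and range `b` corresponding to `g` in the maximal
subgroup. -/
noncomputable def arrow (b : ClassIdem e) (g : maximalSubgroup e) (a : ClassIdem e) : S :=
  transporter he b * g * (transporter he a)⁻¹

theorem arrow_domain_range (b : ClassIdem e) (g : maximalSubgroup e) (a : ClassIdem e) :
    (arrow he b g a)⁻¹ * arrow he b g a = a.1 ∧
      arrow he b g a * (arrow he b g a)⁻¹ = b.1 := by
  have h1 : (transporter he b)⁻¹ * transporter he b = g.1 * g.1⁻¹ := by
    rw [transporter_domain, g.2.2]
  have h2 : (transporter he b * g.1)⁻¹ * (transporter he b * g.1) =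
      (transporter he a)⁻¹ * (transporter he a)⁻¹⁻¹ := by
    rw [mul_domain h1, g.2.1, inv_inv', transporter_domain]
  rw [arrow]
  exact ⟨by rw [mul_domain h2, inv_inv', transporter_range],
    by rw [mul_range h2, mul_range h1, transporter_range]⟩

theorem transport_arrow (b : ClassIdem e) (g : maximalSubgroup e) (a : ClassIdem e) :
    (transporter he b)⁻¹ * arrow he b g a * transporter he a = g.1 := by
  calc _ = ((transporter he b)⁻¹ * transporter he b) * g.1 *
        ((transporter he a)⁻¹ * transporter he a) := by
        rw [arrow]; simp only [mul_assoc]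
    _ = g.1 := by
        rw [transporter_domain, transporter_domain, idem_mul_maximalSubgroup,
          maximalSubgroup_mul_idem]

theorem arrow_transport {s : S} {a b : ClassIdem e} (h : s⁻¹ * s = a.1 ∧ s * s⁻¹ = b.1) :
    arrow he b ⟨_, transport_mem he h⟩ a = s := by
  calc _ = (transporter he b * (transporter he b)⁻¹) * s *
        (transporter he a * (transporter he a)⁻¹) := by
        rw [arrow]; simp only [mul_assoc]
    _ = s := by
        rw [transporter_range, transporter_range, ← h.1, ← h.2, mul_inv_mul, ← mul_assoc,
          mul_inv_mul]

variable {U : Type*} [AddCommGroup U] [Module ℂ U]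
  (ψ : MonoidAlgebra ℂ (maximalSubgroup e) →ₙₐ[ℂ] Module.End ℂ U)

open Classical in
/-- The block in row `b` and column `a` of the operator by which `⌊s⌋` acts on an induced
representation. -/
noncomputable def inducedBlock (b : ClassIdem e) (s : S) (a : ClassIdem e) : Module.End ℂ U :=
  if h : s⁻¹ * s = a.1 ∧ s * s⁻¹ = b.1 then
    ψ (MonoidAlgebra.single ⟨_, transport_mem he h⟩ 1) else 0

theorem inducedBlock_of_mem {a b : ClassIdem e} {s : S}
    (h : s⁻¹ * s = a.1 ∧ s * s⁻¹ = b.1) :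
    inducedBlock he ψ b s a = ψ (MonoidAlgebra.single ⟨_, transport_mem he h⟩ 1) := dif_pos h

theorem inducedBlock_of_domain_ne {a b : ClassIdem e} {s : S} (h : s⁻¹ * s ≠ a.1) :
    inducedBlock he ψ b s a = 0 := dif_neg fun h' => h h'.1

theorem inducedBlock_of_range_ne {a b : ClassIdem e} {s : S} (h : s * s⁻¹ ≠ b.1) :
    inducedBlock he ψ b s a = 0 := dif_neg fun h' => h h'.2

theorem inducedBlock_arrow (b : ClassIdem e) (g : maximalSubgroup e) (a : ClassIdem e) :
    inducedBlock he ψ b (arrow he b g a) a = ψ (MonoidAlgebra.single g 1) := by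
  rw [inducedBlock_of_mem he ψ (arrow_domain_range he b g a)]
  congr 2
  exact Subtype.ext (transport_arrow he b g a)

variable [Fintype S]

noncomputable instance : Fintype (ClassIdem e) :=
  haveI : Finite (ClassIdem e) := Subtype.finite
  Fintype.ofFinite _

noncomputable instance : DecidableEq (ClassIdem e) := Classical.decEq _

theorem card_classIdem (e : S) : Fintype.card (ClassIdem e) = numIdempotents (dClass e) := by
  rw [← Nat.card_eq_fintype_card]
  exact Nat.card_coe_set_eq {a : S | IsIdempotentElem a ∧ dClass a = dClass e}

-- This is multiplicativity of the block matrices. Only the middle index equal to both `s⁻¹ * s` and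
-- `t * t⁻¹` can contribute; there the inner transporters multiply to `t * t⁻¹`, which `t` absorbs.
open Classical in
theorem sum_inducedBlock_mul (c : ClassIdem e) (s t : S) (a : ClassIdem e) :
    ∑ b, inducedBlock he ψ c s b * inducedBlock he ψ b t a =
      if s⁻¹ * s = t * t⁻¹ then inducedBlock he ψ c (s * t) a else 0 := by
  split_ifs with hst
  · by_cases hta : t⁻¹ * t = a.1
    · have hd : dClass (t * t⁻¹) = dClass e := by
        rw [dClass_mul_inv, ← dClass_inv_mul, hta, a.2.2]
      obtain ⟨r, hr⟩ : ∃ r : ClassIdem e, r.1 = t * t⁻¹ := ⟨⟨_, idem_mul_inv t, hd⟩, rfl⟩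
      rw [Finset.sum_eq_single r]
      · by_cases hsc : s * s⁻¹ = c.1
        · rw [inducedBlock_of_mem he ψ ⟨hst.trans hr.symm, hsc⟩,
            inducedBlock_of_mem he ψ ⟨hta, hr.symm⟩,
            inducedBlock_of_mem he ψ ⟨(mul_domain hst).trans hta, (mul_range hst).trans hsc⟩,
            ← map_mul, MonoidAlgebra.single_mul_single, mul_one]
          congr 2
          apply Subtype.ext
          calc (transporter he c)⁻¹ * s * transporter he r *
                ((transporter he r)⁻¹ * t * transporter he a)
              = (transporter he c)⁻¹ * s * (transporter he r * (transporter he r)⁻¹ * t) *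
                  transporter he a := by simp only [mul_assoc]
            _ = (transporter he c)⁻¹ * (s * t) * transporter he a := by
                rw [transporter_range, hr, mul_inv_mul]; simp only [mul_assoc]
        · rw [inducedBlock_of_range_ne he ψ hsc, zero_mul, inducedBlock_of_range_ne]
          rwa [mul_range hst]
      · intro b _ hb
        rw [inducedBlock_of_range_ne he ψ (b := b), mul_zero]
        intro h
        exact hb (Subtype.ext (h.symm.trans hr.symm))
      · intro h
        exact (h (Finset.mem_univ _)).elim
    · rw [inducedBlock_of_domain_ne]
      · refine Finset.sum_eq_zero fun b _ => ?_
        rw [inducedBlock_of_domain_ne he ψ hta, mul_zero]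
      · rwa [mul_domain hst]
  · refine Finset.sum_eq_zero fun b _ => ?_
    by_cases h : s⁻¹ * s = b.1
    · rw [inducedBlock_of_range_ne he ψ (b := b) (s := t), mul_zero]
      intro h'
      exact hst (h.trans h'.symm)
    · rw [inducedBlock_of_domain_ne he ψ h, zero_mul]

/-- The operator by which `⌊s⌋` acts on an induced representation. -/
noncomputable def inducedOp (s : S) : Module.End ℂ (ClassIdem e → U) :=
  LinearMap.pi fun b => ∑ a, (inducedBlock he ψ b s a).comp (LinearMap.proj a)

theorem inducedOp_apply (s : S) (v : ClassIdem e → U) (b : ClassIdem e) :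
    inducedOp he ψ s v b = ∑ a, inducedBlock he ψ b s a (v a) := by
  simp [inducedOp, LinearMap.sum_apply]

open Classical in
theorem inducedOp_mul (s t : S) : inducedOp he ψ s * inducedOp he ψ t =
    if s⁻¹ * s = t * t⁻¹ then inducedOp he ψ (s * t) else 0 := by
  refine LinearMap.ext fun v => funext fun c => ?_
  have h : (if s⁻¹ * s = t * t⁻¹ then inducedOp he ψ (s * t) else 0) v c =
      ∑ a, (if s⁻¹ * s = t * t⁻¹ then inducedBlock he ψ c (s * t) a else 0) (v a) := by
    split_ifs
    · exact inducedOp_apply he ψ _ _ _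
    · simp
  rw [h, Module.End.mul_apply, inducedOp_apply]
  simp only [inducedOp_apply, map_sum, ← sum_inducedBlock_mul, LinearMap.sum_apply,
    Module.End.mul_apply]
  exact Finset.sum_comm

/-- The representation of `ℂS` induced from a representation of a maximal subgroup. -/
noncomputable def induced : MonoidAlgebra ℂ S →ₙₐ[ℂ] Module.End ℂ (ClassIdem e → U) :=
  groupoidLift (inducedOp he ψ) (inducedOp_mul he ψ)

theorem induced_groupoidElement (s : S) (v : ClassIdem e → U) (b : ClassIdem e) :
    induced he ψ (groupoidElement s) v b = ∑ a, inducedBlock he ψ b s a (v a) := by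
  rw [induced, groupoidLift_groupoidElement, inducedOp_apply]

theorem induced_single (s : S) (a : ClassIdem e) (u : U) (b : ClassIdem e) :
    induced he ψ (groupoidElement s) (Pi.single a u) b = inducedBlock he ψ b s a u := by
  rw [induced_groupoidElement, Finset.sum_eq_single a, Pi.single_eq_same]
  · intro a' _ h
    rw [Pi.single_eq_of_ne h, map_zero]
  · intro h
    exact (h (Finset.mem_univ _)).elim

theorem induced_eq_zero_of_dClass_ne {s : S} (h : dClass s ≠ dClass e) :
    induced he ψ (groupoidElement s) = 0 := by
  refine LinearMap.ext fun v => funext fun b => ?_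
  rw [induced_groupoidElement]
  refine Finset.sum_eq_zero fun a _ => ?_
  rw [inducedBlock_of_domain_ne]
  · rfl
  · intro h'
    apply h
    rw [← dClass_inv_mul, h', a.2.2]

/-- Arrows act as matrix units with coefficient `ψ g`. The irreducibility and isomorphism arguments
for induced representations rest on this. -/
theorem induced_arrow (b : ClassIdem e) (g : maximalSubgroup e) (a : ClassIdem e)
    (v : ClassIdem e → U) : induced he ψ (groupoidElement (arrow he b g a)) v =
      Pi.single b (ψ (MonoidAlgebra.single g 1) (v a)) := by
  funext c
  rw [induced_groupoidElement, Finset.sum_eq_single a]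
  · by_cases hc : c = b
    · subst hc
      rw [inducedBlock_arrow, Pi.single_eq_same]
    · rw [Pi.single_eq_of_ne hc, inducedBlock_of_range_ne, LinearMap.zero_apply]
      rw [(arrow_domain_range he b g a).2]
      exact fun h => hc (Subtype.ext h.symm)
  · intro a' _ h
    rw [inducedBlock_of_domain_ne, LinearMap.zero_apply]
    rw [(arrow_domain_range he b g a).1]
    exact fun h' => h (Subtype.ext h'.symm)
  · intro h
    exact (h (Finset.mem_univ _)).elim

/-- The blocks of the Fourier transform at an induced representation are Fourier transforms on
the maximal subgroup of restrictions of the zeta transform. -/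
theorem induced_toAlgebra_single (f : S → ℂ) (a b : ClassIdem e) (u : U) :
    induced he ψ (toAlgebra f) (Pi.single a u) b =
      ψ (toAlgebra fun g => zetaTransform f (arrow he b g a)) u := by
  have : Fintype (maximalSubgroup e) := Fintype.ofFinite _
  rw [toAlgebra_eq_sum_zetaTransform, toAlgebra_eq_sum, map_sum, map_sum, LinearMap.sum_apply,
    LinearMap.sum_apply, Finset.sum_apply]
  symm
  -- The subgroup enumerates the elements of `S` from `a` to `b`; all others have zero `(b, a)`
  -- block and drop out of the sum over `S`.
  refine Finset.sum_of_injOn (fun g => arrow he b g a) ?_ ?_ ?_ ?_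
  · intro g _ g' _ h
    apply Subtype.ext
    rw [← transport_arrow he b g a, ← transport_arrow he b g' a]
    exact congrArg (fun s => (transporter he b)⁻¹ * s * transporter he a) h
  · intro g _
    exact Finset.mem_coe.2 (Finset.mem_univ _)
  · intro s _ hs
    rw [map_smul, LinearMap.smul_apply, Pi.smul_apply, induced_single, inducedBlock, dif_neg,
      LinearMap.zero_apply, smul_zero]
    intro h
    exact hs ⟨⟨_, transport_mem he h⟩, Finset.mem_coe.2 (Finset.mem_univ _),
      arrow_transport he h⟩
  · intro g _
    rw [map_smul, map_smul, LinearMap.smul_apply, LinearMap.smul_apply, Pi.smul_apply,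
      induced_single, inducedBlock_arrow]

end InverseSemigroup

/-! ### Irreducibility, isomorphism and reciprocity for induced representations. -/

namespace InverseSemigroup

open SemigroupFourier

variable {S : Type u} [InverseSemigroup S] {e : S}

/-- The identity of the maximal subgroup at `e`. -/
def maximalSubgroupOne (he : IsIdempotentElem e) : maximalSubgroup e :=
  ⟨e, by rw [inv_idem he]; exact he.eq, by rw [inv_idem he]; exact he.eq⟩

theorem maximalSubgroup_mul_one (he : IsIdempotentElem e) (g : maximalSubgroup e) :
    g * maximalSubgroupOne he = g := Subtype.ext (maximalSubgroup_mul_idem g)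

section Subgroup

variable (he : IsIdempotentElem e) {U U' : Type*} [AddCommGroup U] [Module ℂ U]
  [AddCommGroup U'] [Module ℂ U']
  {ψ : MonoidAlgebra ℂ (maximalSubgroup e) →ₙₐ[ℂ] Module.End ℂ U}
  {ψ' : MonoidAlgebra ℂ (maximalSubgroup e) →ₙₐ[ℂ] Module.End ℂ U'}

theorem eq_zero_of_single (h : ∀ g, ψ (MonoidAlgebra.single g 1) = 0) : ψ = 0 :=
  eq_zero_of_basis (MonoidAlgebra.basis (maximalSubgroup e) ℂ) fun g => by
    rw [MonoidAlgebra.basis_apply, h]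

/-- An irreducible representation of a maximal subgroup preserves the identity. -/
theorem single_one_apply (hψ : IsIrreducibleAction ψ) (u : U) :
    ψ (MonoidAlgebra.single (maximalSubgroupOne he) 1) u = u := by
  have h1 : ∀ g u, ψ (MonoidAlgebra.single g 1)
      (ψ (MonoidAlgebra.single (maximalSubgroupOne he) 1) u) =
        ψ (MonoidAlgebra.single g 1) u := fun g u => by
    rw [← Module.End.mul_apply, ← map_mul, MonoidAlgebra.single_mul_single,
      maximalSubgroup_mul_one, mul_one]
  -- A vector killed by the identity is killed by every group element, so the kernel is invariant,
  -- and it is not everything because `ψ ≠ 0`. An idempotent operator with zero kernel is the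
  -- identity.
  have hker : LinearMap.ker (ψ (MonoidAlgebra.single (maximalSubgroupOne he) 1)) = ⊥ := by
    refine (hψ.2 _ fun x w hw => ?_).resolve_right fun h => hψ.1 (eq_zero_of_single fun g => ?_)
    · refine action_mem_of_basis (MonoidAlgebra.basis (maximalSubgroup e) ℂ) ψ _ w
        (fun g => ?_) x
      rw [LinearMap.mem_ker] at hw
      rw [MonoidAlgebra.basis_apply, ← h1, hw, map_zero]
      exact Submodule.zero_mem _
    · refine LinearMap.ext fun u => ?_
      rw [← h1, LinearMap.ker_eq_top.1 h, LinearMap.zero_apply, map_zero]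
  exact LinearMap.ker_eq_bot.1 hker (h1 _ u)

variable [Fintype S]

theorem eq_zero_of_groupoidElement {V : Type*} [AddCommGroup V] [Module ℂ V]
    {φ : MonoidAlgebra ℂ S →ₙₐ[ℂ] Module.End ℂ V} (h : ∀ s, φ (groupoidElement s) = 0) :
    φ = 0 :=
  eq_zero_of_basis (groupoidBasis S) fun s => by rw [groupoidBasis_apply, h]

/-- For invariant `W`, the vectors of `U` whose copy at `b` lies in `W` form a subspace invariant
under the loops at `b`. A nonzero coordinate `w a` of some `w ∈ W` is carried to position `b` by a
matrix unit, so this subspace is all of `U`, for every `b`. -/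
theorem induced_isIrreducible (hψ : IsIrreducibleAction ψ) :
    IsIrreducibleAction (induced he ψ) := by
  refine ⟨fun h => hψ.1 (eq_zero_of_single fun g => LinearMap.ext fun u => ?_), fun W hW => ?_⟩
  · let a : ClassIdem e := ⟨e, he, rfl⟩
    rw [← inducedBlock_arrow he ψ a g a, ← induced_single, h]
    rfl
  · refine or_iff_not_imp_left.2 fun hbot => ?_
    obtain ⟨w, hw, hw0⟩ := (Submodule.ne_bot_iff _).1 hbot
    obtain ⟨a, ha⟩ := Function.ne_iff.1 hw0
    have hb : ∀ b, W.comap (LinearMap.single ℂ (fun _ : ClassIdem e => U) b) = ⊤ := by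
      intro b
      refine (hψ.2 _ fun x u hu => ?_).resolve_left fun h => ha ?_
      · refine action_mem_of_basis (MonoidAlgebra.basis (maximalSubgroup e) ℂ) ψ _ u
          (fun g => ?_) x
        have := hW (groupoidElement (arrow he b g b)) _ hu
        rw [LinearMap.single_apply, induced_arrow, Pi.single_eq_same] at this
        rw [MonoidAlgebra.basis_apply]
        exact this
      · have := hW (groupoidElement (arrow he b (maximalSubgroupOne he) a)) w hw
        rw [induced_arrow, single_one_apply he hψ] at this
        have hmem : w a ∈ W.comap (LinearMap.single ℂ (fun _ : ClassIdem e => U) b) := this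
        rw [h] at hmem
        exact (Submodule.mem_bot ℂ).1 hmem
    refine Submodule.eq_top_iff'.2 fun v => ?_
    rw [← Finset.univ_sum_single v]
    refine Submodule.sum_mem _ fun b _ => ?_
    have hmem : v b ∈ W.comap (LinearMap.single ℂ (fun _ : ClassIdem e => U) b) := by
      rw [hb b]; trivial
    exact hmem

/-- The diagonal matrix unit at `a` projects onto the `a`-th copy, and an intertwiner commutes with
it; hence it preserves support at `a`. -/
theorem intertwiner_single (hψ : IsIrreducibleAction ψ) (hψ' : IsIrreducibleAction ψ')
    (f : (ClassIdem e → U) →ₗ[ℂ] (ClassIdem e → U'))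
    (hf : ∀ x v, f (induced he ψ x v) = induced he ψ' x (f v)) (a : ClassIdem e) (u : U) :
    Pi.single a (f (Pi.single a u) a) = f (Pi.single a u) := by
  have h := hf (groupoidElement (arrow he a (maximalSubgroupOne he) a)) (Pi.single a u)
  rw [induced_arrow, induced_arrow, single_one_apply he hψ, single_one_apply he hψ',
    Pi.single_eq_same] at h
  exact h.symm

/-- Induction from a fixed maximal subgroup reflects isomorphism. -/
theorem actionEquiv_of_induced (hψ : IsIrreducibleAction ψ) (hψ' : IsIrreducibleAction ψ')
    (h : ActionEquiv (induced he ψ) (induced he ψ')) : ActionEquiv ψ ψ' := by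
  obtain ⟨f, hf⟩ := h
  have hf' : ∀ x v, f.symm (induced he ψ' x v) = induced he ψ x (f.symm v) := fun x v => by
    rw [f.symm_apply_eq, hf, f.apply_symm_apply]
  let a : ClassIdem e := ⟨e, he, rfl⟩
  let φ : U →ₗ[ℂ] U' := (LinearMap.proj a).comp (f.toLinearMap.comp (LinearMap.single ℂ _ a))
  let φ' : U' →ₗ[ℂ] U :=
    (LinearMap.proj a).comp (f.symm.toLinearMap.comp (LinearMap.single ℂ _ a))
  have hφ : ∀ u, φ u = f (Pi.single a u) a := fun _ => rfl
  have hφ' : ∀ u, φ' u = f.symm (Pi.single a u) a := fun _ => rfl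
  have hs : ∀ u, Pi.single a (φ u) = f (Pi.single a u) :=
    intertwiner_single he hψ hψ' f.toLinearMap hf a
  have hs' : ∀ u, Pi.single a (φ' u) = f.symm (Pi.single a u) :=
    intertwiner_single he hψ' hψ f.symm.toLinearMap hf' a
  refine ⟨LinearEquiv.ofLinearMap φ φ'
    (LinearMap.ext fun u => ?_) (LinearMap.ext fun u => ?_), fun x u => ?_⟩
  · rw [LinearMap.comp_apply, hφ, hs', f.apply_symm_apply, Pi.single_eq_same]
    rfl
  · rw [LinearMap.comp_apply, hφ', hs, f.symm_apply_apply, Pi.single_eq_same]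
    rfl
  · refine intertwine_of_basis (MonoidAlgebra.basis (maximalSubgroup e) ℂ) φ u (fun g => ?_) x
    have h1 := hf (groupoidElement (arrow he a g a)) (Pi.single a u)
    rw [induced_arrow, induced_arrow, Pi.single_eq_same] at h1
    rw [MonoidAlgebra.basis_apply, hφ, hφ, h1, Pi.single_eq_same]

/-- Isomorphic representations induced from irreducible ones come from the same `𝒟`-class. -/
theorem dClass_eq_of_induced {e' : S} (he' : IsIdempotentElem e')
    {ψ' : MonoidAlgebra ℂ (maximalSubgroup e') →ₙₐ[ℂ] Module.End ℂ U'}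
    (hψ : IsIrreducibleAction ψ) (h : ActionEquiv (induced he ψ) (induced he' ψ')) :
    dClass e = dClass e' := by
  by_contra hne
  obtain ⟨f, hf⟩ := h
  -- If the classes differed, every `⌊s⌋` would act as zero on one of the two isomorphic
  -- representations, hence on the first, which would vanish.
  refine (induced_isIrreducible he hψ).1 (eq_zero_of_groupoidElement fun s => ?_)
  by_cases hs : dClass s = dClass e
  · refine LinearMap.ext fun v => f.injective ?_
    rw [hf, induced_eq_zero_of_dClass_ne he' ψ' fun h => hne (hs.symm.trans h)]
    simp
  · exact induced_eq_zero_of_dClass_ne he ψ hs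

variable {V : Type*} [AddCommGroup V] [Module ℂ V]
  {φ : MonoidAlgebra ℂ S →ₙₐ[ℂ] Module.End ℂ V}

theorem map_groupoidElement_mul (φ : MonoidAlgebra ℂ S →ₙₐ[ℂ] Module.End ℂ V) {s t : S}
    (h : s⁻¹ * s = t * t⁻¹) (v : V) :
    φ (groupoidElement s) (φ (groupoidElement t) v) = φ (groupoidElement (s * t)) v := by
  rw [← Module.End.mul_apply, ← map_mul, groupoidElement_mul_of_eq h]

theorem map_groupoidElement_mul_of_ne (φ : MonoidAlgebra ℂ S →ₙₐ[ℂ] Module.End ℂ V) {s t : S}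
    (h : s⁻¹ * s ≠ t * t⁻¹) (v : V) :
    φ (groupoidElement s) (φ (groupoidElement t) v) = 0 := by
  rw [← Module.End.mul_apply, ← map_mul, groupoidElement_mul_of_ne h, map_zero,
    LinearMap.zero_apply]

/-- Frobenius reciprocity, as far as it is needed: a nonzero map from `ψ` to the restriction of
`φ` yields an isomorphism of the induced representation with `φ`. -/
theorem induced_actionEquiv (hψ : IsIrreducibleAction ψ) (hφ : IsIrreducibleAction φ)
    (h : U →ₗ[ℂ] V) (h0 : h ≠ 0)
    (hh : ∀ g u, h (ψ (MonoidAlgebra.single g 1) u) = φ (groupoidElement (g : S)) (h u)) :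
    ActionEquiv (induced he ψ) φ := by
  have he' : ∀ u, φ (groupoidElement e) (h u) = h u := fun u => by
    have h1 := hh (maximalSubgroupOne he) u
    rw [single_one_apply he hψ] at h1
    exact h1.symm
  -- The copy of `U` at `a` is mapped into `V` by `h` followed by the transporter from `e` to `a`.
  let F : (ClassIdem e → U) →ₗ[ℂ] V :=
    ∑ a, (φ (groupoidElement (transporter he a))).comp (h.comp (LinearMap.proj a))
  have hF : ∀ v, F v = ∑ a, φ (groupoidElement (transporter he a)) (h (v a)) := fun v => by
    simp [F, LinearMap.sum_apply]
  have hpe : ∀ a : ClassIdem e, (transporter he a)⁻¹ * transporter he a = e * e⁻¹ := fun a => by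
    rw [transporter_domain, inv_idem he, he.eq]
  refine actionEquiv_of_intertwiner (induced_isIrreducible he hψ) hφ F (fun x v => ?_) ?_
  · refine intertwine_of_basis (groupoidBasis S) F v (fun s => ?_) x
    rw [groupoidBasis_apply, hF, hF, map_sum]
    simp only [induced_groupoidElement, map_sum]
    rw [Finset.sum_comm]
    refine Finset.sum_congr rfl fun a _ => ?_
    by_cases ha : s⁻¹ * s = a.1
    · have hd : dClass (s * s⁻¹) = dClass e := by
        rw [dClass_mul_inv, ← dClass_inv_mul, ha, a.2.2]
      obtain ⟨b, hb⟩ : ∃ b : ClassIdem e, b.1 = s * s⁻¹ := ⟨⟨_, idem_mul_inv s, hd⟩, rfl⟩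
      rw [Finset.sum_eq_single b]
      · rw [inducedBlock_of_mem he ψ ⟨ha, hb.symm⟩, hh, map_groupoidElement_mul,
          map_groupoidElement_mul]
        · have : transporter he b * ((transporter he b)⁻¹ * s * transporter he a) =
              s * transporter he a := by
            rw [← mul_assoc, ← mul_assoc, transporter_range, hb, mul_inv_mul]
          rw [this]
        · rw [transporter_range, ha]
        · rw [transporter_domain, (transport_mem he ⟨ha, hb.symm⟩).2]
      · intro b' _ hb'
        rw [inducedBlock_of_range_ne, LinearMap.zero_apply, map_zero, map_zero]
        intro h'
        exact hb' (Subtype.ext (h'.symm.trans hb.symm))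
      · intro h'
        exact (h' (Finset.mem_univ _)).elim
    · rw [map_groupoidElement_mul_of_ne]
      · refine Finset.sum_eq_zero fun b _ => ?_
        rw [inducedBlock_of_domain_ne he ψ ha, LinearMap.zero_apply, map_zero, map_zero]
      · rwa [transporter_range]
  · intro hF0
    refine h0 (LinearMap.ext fun u => ?_)
    let a : ClassIdem e := ⟨e, he, rfl⟩
    have h1 : F (Pi.single a u) = φ (groupoidElement (transporter he a)) (h u) := by
      rw [hF, Finset.sum_eq_single a, Pi.single_eq_same]
      · intro b _ hb
        rw [Pi.single_eq_of_ne hb, map_zero, map_zero]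
      · intro h'
        exact (h' (Finset.mem_univ _)).elim
    rw [hF0, LinearMap.zero_apply] at h1
    -- Undoing the transporter recovers `h u`, since `⌊e⌋` fixes it; so `F = 0` would force `h = 0`.
    have h2 := map_groupoidElement_mul φ (s := (transporter he a)⁻¹) (t := transporter he a)
      (by rw [inv_inv']) (h u)
    rw [← h1, map_zero, transporter_domain, he'] at h2
    rw [← h2, LinearMap.zero_apply]

/-! ### The action of a maximal subgroup on a corner -/

theorem corner_mapsTo (he : IsIdempotentElem e)
    (φ : MonoidAlgebra ℂ S →ₙₐ[ℂ] Module.End ℂ V) (g : maximalSubgroup e)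
    (v : V) : φ (groupoidElement (g : S)) v ∈ LinearMap.range (φ (groupoidElement e)) := by
  refine ⟨φ (groupoidElement (g : S)) v, ?_⟩
  rw [map_groupoidElement_mul, idem_mul_maximalSubgroup]
  rw [g.2.2, inv_idem he, he.eq]

/-- The representation of the maximal subgroup at `e` on the range of the operator `⌊e⌋`. -/
noncomputable def corner (φ : MonoidAlgebra ℂ S →ₙₐ[ℂ] Module.End ℂ V) :
    MonoidAlgebra ℂ (maximalSubgroup e) →ₙₐ[ℂ]
      Module.End ℂ (LinearMap.range (φ (groupoidElement e))) :=
  MonoidAlgebra.liftMagma ℂ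
    { toFun := fun g => (φ (groupoidElement (g : S))).restrict fun v _ => corner_mapsTo he φ g v
      map_mul' := fun g g' => LinearMap.ext fun v => Subtype.ext (by
        change φ (groupoidElement (g.1 * g'.1)) v.1 =
          φ (groupoidElement g.1) (φ (groupoidElement g'.1) v.1)
        rw [map_groupoidElement_mul]
        rw [g.2.1, g'.2.2]) }

theorem corner_single (φ : MonoidAlgebra ℂ S →ₙₐ[ℂ] Module.End ℂ V) (g : maximalSubgroup e)
    (v : LinearMap.range (φ (groupoidElement e))) :
    (corner he φ (MonoidAlgebra.single g 1) v : V) = φ (groupoidElement (g : S)) v := by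
  have h := congrFun (congrArg DFunLike.coe ((MonoidAlgebra.liftMagma ℂ).symm_apply_apply
    ({ toFun := fun g => (φ (groupoidElement (g : S))).restrict fun v _ => corner_mapsTo he φ g v
       map_mul' := fun g g' => LinearMap.ext fun v => Subtype.ext (by
        change φ (groupoidElement (g.1 * g'.1)) v.1 =
          φ (groupoidElement g.1) (φ (groupoidElement g'.1) v.1)
        rw [map_groupoidElement_mul]
        rw [g.2.1, g'.2.2]) } : maximalSubgroup e →ₙ* Module.End ℂ
          (LinearMap.range (φ (groupoidElement e)))))) g
  exact congrArg Subtype.val (LinearMap.congr_fun h v)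

theorem corner_isIrreducible (hφ : IsIrreducibleAction φ) (h0 : φ (groupoidElement e) ≠ 0) :
    IsIrreducibleAction (corner he φ) := by
  have hid : ∀ v, φ (groupoidElement e) (φ (groupoidElement e) v) = φ (groupoidElement e) v :=
    fun v => by
      rw [map_groupoidElement_mul φ, he.eq]
      rw [inv_idem he]
  refine ⟨fun h => h0 (LinearMap.ext fun v => ?_), fun W hW => ?_⟩
  · have h1 := corner_single he φ (maximalSubgroupOne he) ⟨_, v, rfl⟩
    rw [h] at h1
    exact (h1.trans (hid v)).symm
  · refine or_iff_not_imp_left.2 fun hbot => ?_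
    -- All vectors whose whole orbit is compressed into `W` by `⌊e⌋`. This is invariant under `ℂS`
    -- and contains `W`, so it is everything as soon as `W` is nonzero; evaluating at `x = ⌊e⌋` then
    -- puts the whole corner in `W`.
    let W' : Submodule ℂ V :=
      { carrier := {v | ∀ x, φ (groupoidElement e) (φ x v) ∈
          W.map (LinearMap.range (φ (groupoidElement e))).subtype}
        add_mem' := fun hv hw x => by
          rw [map_add, map_add]; exact Submodule.add_mem _ (hv x) (hw x)
        zero_mem' := fun x => by rw [map_zero, map_zero]; exact Submodule.zero_mem _
        smul_mem' := fun c v hv x => by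
          rw [map_smul, map_smul]; exact Submodule.smul_mem _ c (hv x) }
    have hle : ∀ w ∈ W, w.1 ∈ W' := by
      rintro ⟨_, v, rfl⟩ hw x
      have hx : φ x (φ (groupoidElement e) v) ∈
          (W.map (LinearMap.range (φ (groupoidElement e))).subtype).comap
            (φ (groupoidElement e)) := by
        refine action_mem_of_basis (groupoidBasis S) φ _ _ (fun s => ?_) x
        rw [groupoidBasis_apply, Submodule.mem_comap]
        -- The product `⌊e⌋⌊s⌋⌊e⌋` vanishes unless `s` lies in the maximal subgroup, under which `W`
        -- is invariant.
        by_cases h1 : s⁻¹ * s = e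
        · by_cases h2 : s * s⁻¹ = e
          · refine ⟨_, hW (MonoidAlgebra.single ⟨s, h1, h2⟩ 1) _ hw, ?_⟩
            rw [Submodule.subtype_apply, corner_single]
            rw [map_groupoidElement_mul φ (s := e) (t := s)
              (by rw [h2, inv_idem he, he.eq])]
            congr 3
            exact (idem_mul_maximalSubgroup ⟨s, h1, h2⟩).symm
          · rw [map_groupoidElement_mul_of_ne φ (s := e) (t := s)]
            · exact Submodule.zero_mem _
            · rw [inv_idem he, he.eq]
              exact fun h => h2 h.symm
        · rw [map_groupoidElement_mul_of_ne φ (s := s) (t := e), map_zero]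
          · exact Submodule.zero_mem _
          · rwa [inv_idem he, he.eq]
      exact hx
    have hW' : W' = ⊤ := by
      refine (hφ.2 W' fun x w hw y => ?_).resolve_left fun h => hbot ?_
      · rw [← Module.End.mul_apply (φ y), ← map_mul]
        exact hw _
      · refine (Submodule.eq_bot_iff _).2 fun w hw => Subtype.ext ?_
        have := hle w hw
        rw [h] at this
        exact (Submodule.mem_bot ℂ).1 this
    refine Submodule.eq_top_iff'.2 ?_
    rintro ⟨_, v, rfl⟩
    have hv : v ∈ W' := by rw [hW']; trivial
    obtain ⟨w, hw, h⟩ := hv (groupoidElement e)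
    rw [hid] at h
    have : w = ⟨φ (groupoidElement e) v, v, rfl⟩ := Subtype.ext h
    exact this ▸ hw

end Subgroup

/-! ### The complete set of induced irreducible representations. -/

section Classification

variable [Fintype S] {V : Type*} [AddCommGroup V] [Module ℂ V]
  {φ : MonoidAlgebra ℂ S →ₙₐ[ℂ] Module.End ℂ V}

/-- A nonzero representation of `ℂS` does not annihilate all the idempotents `⌊e k⌋`, when the
`e k` represent all `𝒟`-classes. -/
theorem exists_map_groupoidElement_ne_zero {e : DClass S → S}
    (he : ∀ k, IsIdempotentElem (e k) ∧ dClass (e k) = k) (hφ : φ ≠ 0) :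
    ∃ k, φ (groupoidElement (e k)) ≠ 0 := by
  by_contra! h
  refine hφ (eq_zero_of_groupoidElement fun s => LinearMap.ext fun v => ?_)
  have hk := (he (dClass s)).1
  let a : ClassIdem (e (dClass s)) :=
    ⟨s⁻¹ * s, idem_inv_mul s, (dClass_inv_mul s).trans (he (dClass s)).2.symm⟩
  have hd := transporter_domain hk a
  have hr : transporter hk a * (transporter hk a)⁻¹ = s⁻¹ * s := transporter_range hk a
  -- With `p` the transporter from the chosen idempotent to `s⁻¹ * s`, one has `⌊s⌋ = ⌊s
  -- p⌋⌊e⌋⌊p⁻¹⌋`, so `⌊s⌋` is annihilated along with `⌊e⌋`.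
  have h1 := map_groupoidElement_mul φ (s := e (dClass s)) (t := (transporter hk a)⁻¹)
    (by rw [inv_inv', hd, inv_idem hk, hk.eq]) v
  rw [h, LinearMap.zero_apply, mul_transporter_inv] at h1
  have h2 := map_groupoidElement_mul φ (s := s * transporter hk a) (t := (transporter hk a)⁻¹)
    (by rw [mul_domain hr.symm, inv_inv']) v
  rw [← h1, map_zero, mul_assoc, hr, ← mul_assoc, mul_inv_mul] at h2
  rw [← h2, LinearMap.zero_apply]

/-- The matrix representation of `ℂS` induced from a matrix representation of a maximal
subgroup. -/
noncomputable def inducedRep {e : S} (he : IsIdempotentElem e)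
    (ρ : MatrixRep (maximalSubgroup e)) : MatrixRep S :=
  MatrixRep.ofBasis (Pi.basis fun _ : ClassIdem e => Pi.basisFun ℂ (Fin ρ.dim))
    (induced he ρ.action)

theorem inducedRep_actionEquiv {e : S} (he : IsIdempotentElem e)
    (ρ : MatrixRep (maximalSubgroup e)) :
    ActionEquiv (induced he ρ.action) (inducedRep he ρ).action :=
  MatrixRep.ofBasis_actionEquiv _ _

/-- The indices are chosen before `f`: each entry of the large transform is, as a function of `f`,
literally an entry of a subgroup transform, so assembling the output needs no operations. -/
theorem inducedRep_hom_apply {e : S} (he : IsIdempotentElem e)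
    (ρ : MatrixRep (maximalSubgroup e)) (i j : Fin (inducedRep he ρ).dim) :
    ∃ (b a : ClassIdem e) (i' j' : Fin ρ.dim), ∀ f : S → ℂ,
      (inducedRep he ρ).hom (toAlgebra f) i j =
        ρ.hom (toAlgebra fun g => zetaTransform f (arrow he b g a)) i' j' := by
  let p := (Fintype.equivFin (Σ _ : ClassIdem e, Fin ρ.dim)).symm i
  let q := (Fintype.equivFin (Σ _ : ClassIdem e, Fin ρ.dim)).symm j
  refine ⟨p.1, q.1, p.2, q.2, fun f => ?_⟩
  refine (MatrixRep.ofBasis_hom_apply _ _ _ _ _).trans ?_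
  change (Pi.basis fun _ : ClassIdem e => Pi.basisFun ℂ (Fin ρ.dim)).repr
    (induced he ρ.action (toAlgebra f)
      ((Pi.basis fun _ : ClassIdem e => Pi.basisFun ℂ (Fin ρ.dim)) q)) p = _
  rw [Pi.basis_repr, Pi.basis_apply, induced_toAlgebra_single, MatrixRep.action_apply,
    Pi.basisFun_apply, Pi.basisFun_repr, Matrix.mulVec_single_one]
  rfl

/-- The representations induced from complete sets of inequivalent irreducible representations
of maximal subgroups, one for each `𝒟`-class, form a complete set. -/
theorem isCompleteIrreducible_induced {e : DClass S → S}
    (he : ∀ k, IsIdempotentElem (e k) ∧ dClass (e k) = k)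
    {Y : ∀ k, Set (MatrixRep (maximalSubgroup (e k)))}
    (hY : ∀ k, IsCompleteIrreducible (Y k)) :
    IsCompleteIrreducible {σ : MatrixRep S | ∃ k, ∃ ρ ∈ Y k, inducedRep (he k).1 ρ = σ} where
  irreducible := by
    rintro _ ⟨k, ρ, hρ, rfl⟩
    rw [MatrixRep.isIrreducible_iff]
    exact (inducedRep_actionEquiv (he k).1 ρ).isIrreducible (induced_isIrreducible (he k).1
      ((MatrixRep.isIrreducible_iff ρ).1 ((hY k).irreducible ρ hρ)))
  inequivalent := by
    rintro _ ⟨k, ρ, hρ, rfl⟩ _ ⟨k', ρ', hρ', rfl⟩ h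
    have hirr := (MatrixRep.isIrreducible_iff ρ).1 ((hY k).irreducible ρ hρ)
    have hirr' := (MatrixRep.isIrreducible_iff ρ').1 ((hY k').irreducible ρ' hρ')
    have h1 := ((inducedRep_actionEquiv (he k).1 ρ).trans
      ((MatrixRep.equivalent_iff _ _).1 h)).trans (inducedRep_actionEquiv (he k').1 ρ').symm
    have hk : k = k' := by
      rw [← (he k).2, ← (he k').2]
      exact dClass_eq_of_induced _ _ hirr h1
    subst hk
    rw [(hY k).inequivalent ρ hρ ρ' hρ' ((MatrixRep.equivalent_iff _ _).2
      (actionEquiv_of_induced _ hirr hirr' h1))]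
  complete := by
    intro σ hσ
    rw [MatrixRep.isIrreducible_iff] at hσ
    obtain ⟨k, hk⟩ := exists_map_groupoidElement_ne_zero he hσ.1
    have hc := corner_isIrreducible (he k).1 hσ hk
    let b := Module.finBasis ℂ (LinearMap.range (σ.action (groupoidElement (e k))))
    have hb := MatrixRep.ofBasis_actionEquiv b (corner (he k).1 σ.action)
    obtain ⟨ρ, hρ, hρe⟩ := (hY k).complete (MatrixRep.ofBasis b (corner (he k).1 σ.action))
      ((MatrixRep.isIrreducible_iff _).2 (hb.isIrreducible hc))
    have hirr := (MatrixRep.isIrreducible_iff ρ).1 ((hY k).irreducible ρ hρ)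
    obtain ⟨f, hf⟩ := (hb.trans ((MatrixRep.equivalent_iff _ _).1 hρe)).symm
    refine ⟨_, ⟨k, ρ, hρ, rfl⟩, (MatrixRep.equivalent_iff _ _).2 (ActionEquiv.symm ?_)⟩
    refine (inducedRep_actionEquiv (he k).1 ρ).symm.trans (induced_actionEquiv (he k).1 hirr hσ
      ((Submodule.subtype _).comp f.toLinearMap) (fun h => hirr.1 ?_) fun g u => ?_)
    -- As `f` and the inclusion are injective, a zero composite would leave only the zero vector,
    -- making the representation zero.
    · refine NonUnitalAlgHom.ext fun x => LinearMap.ext fun u => f.injective (Subtype.ext ?_)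
      have h1 := fun u => LinearMap.congr_fun h u
      exact (h1 _).trans (by simp)
    · change (f (ρ.action (MonoidAlgebra.single g 1) u) : Fin σ.dim → ℂ) = _
      rw [hf, corner_single]
      rfl

end Classification

end InverseSemigroup

/-! ### The operation count. -/

open InverseSemigroup SemigroupFourier OpCount in
theorem mainTheorem1 (S : Type u) [InverseSemigroup S] [Fintype S] [Nonempty S]
    (e : InverseSemigroup.DClass S → S)
    (he : ∀ k, IsIdempotentElem (e k) ∧ InverseSemigroup.dClass (e k) = k) :
    SemigroupFourier.fourierCost S ≤
      InverseSemigroup.zetaCost S +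
        ∑ k : InverseSemigroup.DClass S,
          (InverseSemigroup.numIdempotents k : ℕ∞) ^ 2 *
            SemigroupFourier.fourierCost (InverseSemigroup.maximalSubgroup (e k)) := by
  by_cases hz : zetaCost S = ⊤
  · rw [hz, top_add]
    exact le_top
  have hcard : ∀ k, Fintype.card (ClassIdem (e k)) = numIdempotents k := fun k => by
    rw [card_classIdem, (he k).2]
  by_cases hG : ∃ k, fourierCost (maximalSubgroup (e k)) = ⊤
  · obtain ⟨k, hk⟩ := hG
    -- In `ℕ∞` the product `0 * ⊤` is `0`, so an infinite subgroup cost makes the bound trivial only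
    -- because the class contains an idempotent, namely `e k`.
    have hr : (numIdempotents k : ℕ∞) ≠ 0 := by
      have : Nonempty (ClassIdem (e k)) := ⟨⟨e k, (he k).1, rfl⟩⟩
      rw [← hcard]
      exact_mod_cast Fintype.card_ne_zero
    have htop : (numIdempotents k : ℕ∞) ^ 2 * fourierCost (maximalSubgroup (e k)) = ⊤ := by
      rw [hk]
      exact ENat.mul_top (pow_ne_zero 2 hr)
    refine le_top.trans (le_trans ?_ le_add_self)
    rw [← htop]
    exact Finset.single_le_sum (f := fun k => (numIdempotents k : ℕ∞) ^ 2 *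
      fourierCost (maximalSubgroup (e k))) (fun _ _ => zero_le) (Finset.mem_univ k)
  push Not at hG
  choose Y m hY hm hcost using fun k => exists_complete_of_fourierCost_ne_top (hG k)
  obtain ⟨m₀, ⟨L, hL, hlen, hav⟩, hm₀⟩ := exists_computableIn_of_cost_ne_top hz
  -- One subgroup transform for each class `k` and each pair `(b, a)` of its idempotents, fed with
  -- the zeta coefficients along the arrows from `a` to `b`; the number of pairs gives the factor
  -- `r_k ^ 2`.
  obtain ⟨L', hL', -, hlen', hav'⟩ := hL.extend
    (τ := Σ k : DClass S, ClassIdem (e k) × ClassIdem (e k))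
    (fun t => fourierTransform (Y t.1)) (fun t => m t.1) (fun t => hm t.1)
    (fun t f g => zetaTransform f (arrow (he t.1).1 t.2.1 g t.2.2))
    (fun _ _ => hav _) Finset.univ
  have hcomp : ComputableIn (fourierTransform
      {σ : MatrixRep S | ∃ k, ∃ ρ ∈ Y k, inducedRep (he k).1 ρ = σ}) L'.length := by
    refine ⟨L', hL', rfl, ?_⟩
    rintro ⟨⟨_, k, ρ, hρ, rfl⟩, i, j⟩
    obtain ⟨b, a, i', j', h⟩ := inducedRep_hom_apply (he k).1 ρ i j
    have := hav' ⟨k, b, a⟩ (Finset.mem_univ _) ⟨⟨ρ, hρ⟩, i', j'⟩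
    simp only [fourierTransform, h]
    exact this
  refine (iInf₂_le _ (isCompleteIrreducible_induced he hY)).trans (hcomp.cost_le.trans ?_)
  have hz' : zetaCost S = m₀ := hm₀
  rw [hlen', hlen, hz', Fintype.sum_sigma]
  simp only [hcost, Finset.sum_const, Finset.card_univ, Fintype.card_prod, hcard, smul_eq_mul]
  push_cast
  simp only [sq, le_refl]
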